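/- Let $K$ be a field, $\mathrm{vect}_K$ the category of finite dimensional $K$-vector spaces, $I$ a finite poset, and $G\colon I\to \mathrm{vect}_K$ a functor. **Betti diagrams.** A functor $F\colon I\to\mathrm{vect}_K$ is *free* if it is isomorphic to the left Kan extension, along the identity map $(I,=)\to I$ from the discrete poset, of a family $V=\{V_a\}_{a\in I}$ of finite dimensional vector spaces; $V$ (unique up to isomorphism) is the Betti diagram $\beta F$ of $F$. For $n\in\{1,2,\dots,\infty\}$, an *$n$-resolution* of $G$ is an exact sequence $P_{n-1}\to\cdots\to P_0\to G\to 0$ (infinite to the left if $n=\infty$) with all $P_i$ free. It is *minimal* if every chain map $\phi\colon P\to P$ commuting with $P_0\to G$ is an isomorphism. If $P\to G$ is a minimal $n$-resolution and $i<n$, then $\beta^iG:=\beta P_i$ is the $i$-th Betti diagram of $G$. **Koszul complex.** Let $a\in I$. A parent of $a$ is an element $x<a$ such that no $y$ satisfies $x<y<a$; $\mathcal P(a)$ is the set of parents of $a$. A subset $S\subset I$ has an ancestor if some $b\in I$ satisfies $b\le s$ for all $s\in S$. The product $\bigwedge S$ is the greatest lower bound of $S$ in $I$. Choose a linear ordering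 $\prec$ on $\mathcal P(a)$. The Koszul complex $\mathcal K_aG$ is the non-negative chain complex with $(\mathcal K_aG)_0=G(a)$ and, for $k>0$, $$(\mathcal K_aG)_k=\bigoplus_{\substack{S\subset\mathcal P(a),\ |S|=k\\ S\text{ has an ancestor}}}\ \mathrm{colim}_{\{x\in I\,:\,x\le s\ \forall s\in S\}}\,G .$$ Its differential $(\mathcal K_aG)_1\to G(a)$ is given by the maps $G(s<a)$ on the summands $\mathrm{colim}_{\{x\le s\}}G=G(s)$, and for $k>0$ the differential $(\mathcal K_aG)_{k+1}\to(\mathcal K_aG)_k$ is $\sum_{j=0}^k(-1)^j\partial_j$, where $\partial_j$ maps the summand of $S=\{s_0\prec\cdots\prec s_k\}$ to the summand of $S\setminus\{s_j\}$ by the map of colimits induced by the inclusion of indexing posets. **Theorem.** The functor $G$ has a minimal $\infty$-resolution, so that all its Betti diagrams are defined, and for every $a\in I$ (and every choice of $\prec$): 1. for $i=0,1,2$, the vector spaces $(\beta^iG)_a$ and $H_i(\mathcal K_aG)$ are isomorphic; 2. if every non-empty subset $S\subset\mathcal P(a)$ which has an ancestor has the product $\bigwedge S$ in $I$, then, for every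 $i\ge 0$, the vector spaces $(\beta^iG)_a$ and $H_i(\mathcal K_aG)$ are isomorphic. -/

import Mathlib

open CategoryTheory CategoryTheory.Limits

universe u w

-- so that `X ⟶ Y` is always elaborated with the quiver structure of the category itself
attribute [-instance] CategoryTheory.catToReflQuiver

noncomputable section

namespace Koszul

section Poset

variable {I : Type w} [PartialOrder I]

/-- The set `P(a)` of parents of `a`: the elements `x < a` with nothing strictly in between. -/
def parents (a : I) : Set I := {x | x ⋖ a}

/-- `S` has an ancestor: some element of `I` lies below all elements of `S`. -/
def HasAncestor (S : Set I) : Prop := ∃ b : I, ∀ s ∈ S, b ≤ s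

/-- The subposet `⋂_{s ∈ S} (I ≤ s)` of `I`. -/
def below {a : I} (S : Finset (parents a)) : Set I := {x | ∀ s ∈ S, x ≤ (s : I)}

/-- The index set of the `k`-th direct sum: sets of `k` parents of `a` having an ancestor. -/
abbrev Index (a : I) (k : ℕ) : Type w :=
  {S : Finset (parents a) // S.card = k ∧ HasAncestor ((↑) '' (S : Set (parents a)) : Set I)}

open Classical in
/-- The index `S \ {s}`. -/
def Index.erase {a : I} {k : ℕ} (S : Index a (k + 1)) (s : S.1) : Index a k :=
  ⟨S.1.erase s.1, by rw [Finset.card_erase_of_mem s.2, S.2.1, Nat.add_sub_cancel], by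
    obtain ⟨b, hb⟩ := S.2.2
    refine ⟨b, ?_⟩
    rintro _ ⟨t, ht, rfl⟩
    exact hb _ ⟨t, Finset.mem_of_mem_erase ht, rfl⟩⟩

open Classical in
/-- The position `j` of `s = s_j` in `S = {s_0 ≺ ⋯ ≺ s_k}`, namely the number of elements of `S`
preceding `s`. -/
def position {a : I} (prec : parents a → parents a → Prop) (S : Finset (parents a))
    (s : parents a) : ℕ :=
  (S.filter fun t => prec t s).card

lemma below_mono {a : I} {S T : Finset (parents a)} (h : T ⊆ S) : below S ⊆ below T :=
  fun _ hx s hs => hx s (h hs)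

lemma Index.erase_subset {a : I} {k : ℕ} (S : Index a (k + 1)) (s : S.1) :
    (S.erase s).1 ⊆ S.1 := by
  classical
  exact Finset.erase_subset _ _

lemma le_of_mem_below {a : I} {k : ℕ} (S : Index a (k + 1)) {x : I} (hx : x ∈ below S.1) :
    x ≤ a := by
  obtain ⟨s, hs⟩ : S.1.Nonempty := by
    rw [← Finset.card_pos, S.2.1]; exact Nat.succ_pos k
  exact (hx s hs).trans s.2.le

end Poset

section Complex

variable {K : Type u} [Field K] {I : Type w} [PartialOrder I] [Finite I]

instance (U : Set I) : HasColimitsOfShape U (FGModuleCat.{u} K) := by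
  have : Fintype U := Fintype.ofFinite U
  infer_instance

instance (a : I) (k : ℕ) : HasColimitsOfShape (Discrete (Index a k)) (FGModuleCat.{u} K) := by
  have : Fintype (Index a k) := Fintype.ofFinite _
  infer_instance

/-- The restriction of `G` to the subposet `U`. -/
abbrev restrict (G : I ⥤ FGModuleCat.{u} K) (U : Set I) : U ⥤ FGModuleCat.{u} K :=
  (Subtype.mono_coe (· ∈ U)).functor ⋙ G

/-- `colim_U G`. -/
abbrev colimOn (G : I ⥤ FGModuleCat.{u} K) (U : Set I) : FGModuleCat.{u} K :=
  colimit (restrict G U)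

/-- The structure map `G(x) ⟶ colim_U G`. -/
abbrev inj (G : I ⥤ FGModuleCat.{u} K) (U : Set I) (x : U) : G.obj x ⟶ colimOn G U :=
  colimit.ι (restrict G U) x

lemma map_inj (G : I ⥤ FGModuleCat.{u} K) (U : Set I) {x y : U} (h : x.1 ≤ y.1) :
    G.map (homOfLE h) ≫ inj G U y = inj G U x :=
  colimit.w (restrict G U) (homOfLE h : x ⟶ y)

/-- The map `colim_U G ⟶ colim_W G` induced by an inclusion `U ⊆ W`. -/
def colimMap (G : I ⥤ FGModuleCat.{u} K) {U W : Set I} (h : U ⊆ W) :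
    colimOn G U ⟶ colimOn G W :=
  colimit.desc (restrict G U)
    { pt := colimOn G W
      ι :=
        { app := fun x => inj G W ⟨x.1, h x.2⟩
          naturality := fun x y f => by
            have := map_inj G W (x := ⟨x.1, h x.2⟩) (y := ⟨y.1, h y.2⟩) (leOfHom f)
            exact this.trans (Category.comp_id _).symm } }

/-- The map `colim_U G ⟶ G(a)` induced by the maps `G(x ≤ a)`, where `U` lies below `a`. -/
def colimTo (G : I ⥤ FGModuleCat.{u} K) {U : Set I} {a : I} (h : ∀ x ∈ U, x ≤ a) :
    colimOn G U ⟶ G.obj a :=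
  colimit.desc (restrict G U)
    { pt := G.obj a
      ι :=
        { app := fun x => G.map (homOfLE (h x.1 x.2))
          naturality := fun x y f => by
            have := G.map_comp (homOfLE (leOfHom f : x.1 ≤ y.1)) (homOfLE (h y.1 y.2))
            exact this.symm.trans (Category.comp_id _).symm } }

@[simp]
lemma inj_colimMap (G : I ⥤ FGModuleCat.{u} K) {U W : Set I} (h : U ⊆ W) (x : U) :
    inj G U x ≫ colimMap G h = inj G W ⟨x.1, h x.2⟩ :=
  colimit.ι_desc _ _

@[simp]
lemma inj_colimTo (G : I ⥤ FGModuleCat.{u} K) {U : Set I} {a : I} (h : ∀ x ∈ U, x ≤ a) (x : U) :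
    inj G U x ≫ colimTo G h = G.map (homOfLE (h x.1 x.2)) :=
  colimit.ι_desc _ _

lemma colimMap_comp (G : I ⥤ FGModuleCat.{u} K) {U V W : Set I} (h : U ⊆ V) (h' : V ⊆ W) :
    colimMap G h ≫ colimMap G h' = colimMap G (h.trans h') := by
  refine colimit.hom_ext fun x => ?_
  change inj G U x ≫ _ = inj G U x ≫ _
  rw [← Category.assoc, inj_colimMap, inj_colimMap, inj_colimMap]

lemma colimMap_colimTo (G : I ⥤ FGModuleCat.{u} K) {U V : Set I} {a : I} (h : U ⊆ V)
    (h' : ∀ x ∈ V, x ≤ a) :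
    colimMap G h ≫ colimTo G h' = colimTo G (fun x hx => h' x (h hx)) := by
  refine colimit.hom_ext fun x => ?_
  change inj G U x ≫ _ = inj G U x ≫ _
  rw [← Category.assoc, inj_colimMap, inj_colimTo, inj_colimTo]

variable (G : I ⥤ FGModuleCat.{u} K) (a : I) (prec : parents a → parents a → Prop)

/-- The `k`-th term of the Koszul complex of `G` at `a`. -/
def X : ℕ → FGModuleCat.{u} K
  | 0 => G.obj a
  | k + 1 => ∐ fun S : Index a (k + 1) => colimOn G (below S.1)

/-- The inclusion of the summand indexed by `S` into the `(k + 1)`-st term. -/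
def incl {k : ℕ} (S : Index a (k + 1)) : colimOn G (below S.1) ⟶ X G a (k + 1) :=
  Sigma.ι (fun S : Index a (k + 1) => colimOn G (below S.1)) S

/-- The map out of the `(k + 1)`-st term with given components. -/
def desc {k : ℕ} {M : FGModuleCat.{u} K}
    (f : ∀ S : Index a (k + 1), colimOn G (below S.1) ⟶ M) : X G a (k + 1) ⟶ M :=
  Sigma.desc f

@[simp]
lemma incl_desc {k : ℕ} {M : FGModuleCat.{u} K}
    (f : ∀ S : Index a (k + 1), colimOn G (below S.1) ⟶ M) (S : Index a (k + 1)) :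
    incl G a S ≫ desc G a f = f S :=
  Sigma.ι_desc f S

lemma X_hom_ext {k : ℕ} {M : FGModuleCat.{u} K} {f g : X G a (k + 1) ⟶ M}
    (h : ∀ S, incl G a S ≫ f = incl G a S ≫ g) : f = g :=
  Sigma.hom_ext f g h

/-- The differential of the Koszul complex of `G` at `a`, where `≺` is a linear ordering of the
parents of `a`. In degree `0` it is given by the maps `G(x ≤ a)`, and in higher degrees it is the
alternating sum `∑ (-1)^j ∂_j`, where `∂_j` sends the summand of `S` to that of `S \ {s_j}`. -/
def d : (k : ℕ) → (X G a (k + 1) ⟶ X G a k)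
  | 0 => desc G a fun S => colimTo G fun _ hx => le_of_mem_below S hx
  | _ + 1 => desc G a fun S => ∑ s : S.1, (-1 : ℤ) ^ position prec S.1 s.1 •
      (colimMap G (below_mono (S.erase_subset s)) ≫ incl G a (S.erase s))

lemma incl_d_zero (S : Index a 1) : incl G a S ≫ d G a prec 0 =
    colimTo G fun _ hx => le_of_mem_below S hx :=
  incl_desc G a _ S

lemma incl_d_succ {k : ℕ} (S : Index a (k + 1 + 1)) : incl G a S ≫ d G a prec (k + 1) =
    ∑ s : S.1, (-1 : ℤ) ^ position prec S.1 s.1 •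
      (colimMap G (below_mono (S.erase_subset s)) ≫ incl G a (S.erase s)) :=
  incl_desc G a _ S

end Complex

section Square

variable {I : Type w} [PartialOrder I] {a : I} (prec : parents a → parents a → Prop)

open Classical in
lemma position_erase [IsStrictTotalOrder (parents a) prec] {S : Finset (parents a)}
    {s t : parents a} (hs : s ∈ S) (hst : prec s t) :
    position prec S t = position prec (S.erase s) t + 1 ∧
      position prec (S.erase t) s = position prec S s := by
  constructor
  · unfold position
    rw [Finset.filter_erase, Finset.card_erase_add_one]
    simp [hs, hst]
  · unfold position
    rw [Finset.filter_erase, Finset.erase_eq_of_notMem]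
    simp only [Finset.mem_filter, not_and]
    exact fun _ h => asymm_of prec hst h

open Classical in
lemma sign_swap [IsStrictTotalOrder (parents a) prec] {S : Finset (parents a)}
    {s t : parents a} (hs : s ∈ S) (ht : t ∈ S) (hst : s ≠ t) :
    (-1 : ℤ) ^ (position prec S s + position prec (S.erase s) t) +
      (-1 : ℤ) ^ (position prec S t + position prec (S.erase t) s) = 0 := by
  rcases trichotomous_of prec s t with h | h | h
  · obtain ⟨h1, h2⟩ := position_erase prec hs h
    rw [h1, h2]; ring
  · exact absurd h hst
  · obtain ⟨h1, h2⟩ := position_erase prec ht h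
    rw [h1, h2]; ring

open Classical in
lemma sum_sign_eq_zero [IsStrictTotalOrder (parents a) prec] {M : Type*} [AddCommGroup M] {k : ℕ}
    (S : Index a (k + 1 + 1)) (φ : Index a k → M) :
    ∑ s : S.1, ∑ t : (S.erase s).1,
      (-1 : ℤ) ^ (position prec S.1 s.1 + position prec (S.erase s).1 t.1) •
        φ ((S.erase s).erase t) = 0 := by
  let ψ : Finset (parents a) → M := fun T =>
    if h : T.card = k ∧ HasAncestor ((↑) '' (T : Set (parents a)) : Set I) then φ ⟨T, h⟩ else 0
  let f : parents a → parents a → M := fun s t =>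
    (-1 : ℤ) ^ (position prec S.1 s + position prec (S.1.erase s) t) • ψ ((S.1.erase s).erase t)
  have h1 : ∀ s : S.1, ∑ t : (S.erase s).1,
      (-1 : ℤ) ^ (position prec S.1 s.1 + position prec (S.erase s).1 t.1) •
        φ ((S.erase s).erase t) = ∑ t ∈ S.1.erase s.1, f s t := by
    intro s
    rw [← Finset.sum_coe_sort (S.1.erase s.1)]
    refine Finset.sum_congr rfl fun t _ => ?_
    have : ψ ((S.1.erase s.1).erase t.1) = φ ((S.erase s).erase t) :=
      dif_pos ((S.erase s).erase t).2
    simp only [f, this]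
    rfl
  rw [Finset.sum_congr rfl fun s _ => h1 s,
    Finset.sum_coe_sort S.1 (fun s => ∑ t ∈ S.1.erase s, f s t), Finset.sum_sigma']
  refine Finset.sum_involution (fun x _ => ⟨x.2, x.1⟩) ?_ ?_ ?_ ?_
  · rintro ⟨s, t⟩ h
    simp only [Finset.mem_sigma, Finset.mem_erase] at h
    simp only [f]
    rw [Finset.erase_right_comm (a := t) (b := s), ← add_smul,
      sign_swap prec h.1 h.2.2 (Ne.symm h.2.1), zero_smul]
  · rintro ⟨s, t⟩ h _ h'
    simp only [Finset.mem_sigma, Finset.mem_erase] at h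
    simp only [Sigma.mk.injEq, heq_eq_eq] at h'
    exact h.2.1 h'.1
  · rintro ⟨s, t⟩ h
    simp only [Finset.mem_sigma, Finset.mem_erase] at h ⊢
    exact ⟨h.2.2, Ne.symm h.2.1, h.1⟩
  · rintro ⟨s, t⟩ _
    rfl

end Square

section Complex

variable {K : Type u} [Field K] {I : Type w} [PartialOrder I] [Finite I]
  (G : I ⥤ FGModuleCat.{u} K) (a : I) (prec : parents a → parents a → Prop)

open Classical in
lemma d_comp_d [IsStrictTotalOrder (parents a) prec] (k : ℕ) :
    d G a prec (k + 1) ≫ d G a prec k = 0 := by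
  refine X_hom_ext G a fun S => ?_
  rw [comp_zero, ← Category.assoc, incl_d_succ, Preadditive.sum_comp]
  cases k with
  | zero =>
    have key := sum_sign_eq_zero prec S
      (fun _ : Index a 0 => (colimTo G fun _ hx => le_of_mem_below S hx :
        colimOn G (below S.1) ⟶ X G a 0))
    refine Eq.trans (Finset.sum_congr rfl fun s _ => ?_) key
    have hface : colimMap G (below_mono (S.erase_subset s)) ≫ incl G a (S.erase s) ≫
        d G a prec 0 = (colimTo G fun _ hx => le_of_mem_below S hx :
          colimOn G (below S.1) ⟶ X G a 0) := by
      rw [incl_d_zero]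
      exact colimMap_colimTo G _ _
    rw [Preadditive.zsmul_comp, Category.assoc, hface]
    have hpos : ∀ t : (S.erase s).1, position prec (S.erase s).1 t.1 = 0 := by
      intro t
      obtain ⟨u, hu⟩ := Finset.card_eq_one.mp (S.erase s).2.1
      have ht : t.1 ∈ (S.erase s).1 := t.2
      generalize t.1 = v at ht ⊢
      rw [hu, Finset.mem_singleton] at ht
      rw [position, ht, hu, Finset.card_eq_zero, Finset.filter_eq_empty_iff]
      intro v hv
      rw [Finset.mem_singleton.mp hv]
      exact irrefl_of prec u
    simp only [hpos, add_zero]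
    rw [Finset.sum_const, Finset.card_univ, Fintype.card_coe, (S.erase s).2.1, one_smul]
    rfl
  | succ k =>
    have key := sum_sign_eq_zero prec S (fun T : Index a (k + 1) =>
      if h : T.1 ⊆ S.1 then colimMap G (below_mono h) ≫ incl G a T else 0)
    refine Eq.trans (Finset.sum_congr rfl fun s _ => ?_) key
    rw [Preadditive.zsmul_comp, Category.assoc, incl_d_succ, Preadditive.comp_sum,
      Finset.smul_sum]
    refine Finset.sum_congr rfl fun t _ => ?_
    rw [Preadditive.comp_zsmul, smul_smul, ← pow_add,
      dif_pos (((S.erase s).erase_subset t).trans (S.erase_subset s)), ← Category.assoc,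
      colimMap_comp]

/-- The Koszul complex of `G` at `a`. -/
def complex [IsStrictTotalOrder (parents a) prec] : ChainComplex (FGModuleCat.{u} K) ℕ :=
  ChainComplex.of (X G a) (d G a prec) (d_comp_d G a prec)

end Complex

end Koszul

section Resolutions

variable {K : Type u} [Field K] {J : Type w} [PartialOrder J]

/-- `F` is free (finitely generated) with Betti diagram `V`: the support of `V` is finite and `F` is
a left Kan extension of `V : (J, =) ⥤ vect_K` along the identity functor `(J, =) ⥤ J`. -/
def IsFreeOn (F : J ⥤ FGModuleCat.{u} K) (V : J → FGModuleCat.{u} K) : Prop :=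
  {a | ¬ IsZero (V a)}.Finite ∧
    ∃ α : Discrete.functor V ⟶ Discrete.functor (fun a : J => a) ⋙ F, F.IsLeftKanExtension α

/-- An `n`-resolution of `F`, for an extended natural number `n`: an exact sequence
`P_{n-1} ⟶ ⋯ ⟶ P_0 ⟶ F ⟶ 0` (infinite to the left if `n = ⊤`) in which all `P_i` are free. For finite
`n`, it is viewed as a chain complex that vanishes in degrees `≥ n`. -/
structure Resolution (F : J ⥤ FGModuleCat.{u} K) (n : ℕ∞) where
  complex : ChainComplex (J ⥤ FGModuleCat.{u} K) ℕ
  free : ∀ i : ℕ, (i : ℕ∞) < n → ∃ V, IsFreeOn (complex.X i) V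
  isZero : ∀ i : ℕ, n ≤ (i : ℕ∞) → IsZero (complex.X i)
  aug : complex.X 0 ⟶ F
  d_aug : complex.d 1 0 ≫ aug = 0
  epi_aug : Epi aug
  exact_zero : 1 < n → (ShortComplex.mk (complex.d 1 0) aug d_aug).Exact
  exact_succ : ∀ i : ℕ, ((i + 2 : ℕ) : ℕ∞) < n → complex.ExactAt (i + 1)

/-- A resolution is minimal if every chain map over `F` from it to itself is an isomorphism. -/
def Resolution.IsMinimal {F : J ⥤ FGModuleCat.{u} K} {n : ℕ∞} (P : Resolution F n) : Prop :=
  ∀ φ : P.complex ⟶ P.complex, φ.f 0 ≫ P.aug = P.aug → IsIso φ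

/-- `V` is an `i`-th Betti diagram of `F`: for some `n > i` there is a minimal `n`-resolution `P` of
`F` such that `V` is a Betti diagram of the free functor `P_i`. -/
def IsBettiDiagram (F : J ⥤ FGModuleCat.{u} K) (i : ℕ) (V : J → FGModuleCat.{u} K) : Prop :=
  ∃ (n : ℕ∞) (P : Resolution F n), (i : ℕ∞) < n ∧ P.IsMinimal ∧ IsFreeOn (P.complex.X i) V

end Resolutions

end

/-! The radical of `F` at `a` is the span of the images of the `F(x)` with `x < a`; a cover is an
epimorphism whose kernel lies in the radical. As `I` is finite, Nakayama's lemma holds: a subfunctor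
which together with the radical spans `F` is all of `F`. Lifting a complement of the radical gives a
free cover of every functor. Iterating on kernels gives a resolution, minimal by Nakayama and finite
dimensionality. Conversely, each term of a minimal resolution covers the corresponding syzygy
(`HasBetti.of_isMinimal`): a kernel element outside the radical would produce a non-invertible `1 -
s` that extends to a chain map over the resolved functor.

It remains to compute Koszul homology along a resolution by covers. In degree `0` it is `F(a)`
modulo the radical, which is `V(a)` for a cover with generators `V`
(`IsCover.nonempty_iso_homology_zero`). For free `P` it vanishes in positive degrees: on a generator
at `b < a`, the complex is the augmented chain complex of the full simplex on the parents of `a`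
above `b`, a nonempty set, so coning off a vertex contracts it (`FreeGenerators.exists_homotopy`).

A short exact sequence `0 → Z → P → F → 0` induces a right exact sequence of Koszul complexes,
because colimits are right exact. It is left exact in degrees where every indexing poset has a
greatest element, the colimits being evaluations there. Left exactness up to degree `i` yields
`H_{i+1}(F) ≅ H_i(Z)` (`nonempty_homology_iso`). Degrees `0` and `1` are always left exact, which
suffices for Betti diagrams up to `i = 2`; products of parents give all degrees. -/

noncomputable section

namespace Koszul

/-! ### Free functors and their generators -/

section Free

variable {K : Type u} [Field K] {I : Type w} [PartialOrder I]

/-- Generators `V` of a functor `P` exhibiting every value `P(x)` as the direct sum of the spaces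
`V b` with `b ≤ x`. -/
structure FreeGenerators (P : I ⥤ FGModuleCat.{u} K) (V : I → FGModuleCat.{u} K) where
  /-- The inclusion of the generators. -/
  gen : ∀ b, V b ⟶ P.obj b
  /-- The map out of `P(x)` with given values on generators. -/
  desc : ∀ {x : I} {M : FGModuleCat.{u} K}, (∀ b, b ≤ x → (V b ⟶ M)) → (P.obj x ⟶ M)
  fac : ∀ {x : I} {M : FGModuleCat.{u} K} (f : ∀ b, b ≤ x → (V b ⟶ M)) (b : I) (h : b ≤ x),
    gen b ≫ P.map (homOfLE h) ≫ desc f = f b h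
  hom_ext : ∀ {x : I} {M : FGModuleCat.{u} K} {f g : P.obj x ⟶ M},
    (∀ b (h : b ≤ x), gen b ≫ P.map (homOfLE h) ≫ f = gen b ≫ P.map (homOfLE h) ≫ g) → f = g

/-- The identity map from the discrete poset, as a functor. -/
abbrev discreteTo (I : Type w) [PartialOrder I] : Discrete I ⥤ I :=
  Discrete.functor fun a : I => a

instance [Finite I] (x : I) :
    HasColimitsOfShape (CostructuredArrow (discreteTo I) x) (FGModuleCat.{u} K) := by
  have : Fintype I := Fintype.ofFinite I
  have : Finite (CostructuredArrow (discreteTo I) x) := by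
    refine Finite.of_injective (β := I) (fun f => f.left.as) ?_
    rintro ⟨⟨a⟩, ⟨⟨⟩⟩, f⟩ ⟨⟨b⟩, ⟨⟨⟩⟩, g⟩ (rfl : a = b)
    rw [Subsingleton.elim f g]
  have : Fintype (CostructuredArrow (discreteTo I) x) := Fintype.ofFinite _
  have h : ∀ f g : CostructuredArrow (discreteTo I) x, Finite (f ⟶ g) := by
    intro f g
    have : Subsingleton (f ⟶ g) :=
      ⟨fun a b => CostructuredArrow.hom_ext _ _ (Subsingleton.elim _ _)⟩
    infer_instance
  have : ∀ f g : CostructuredArrow (discreteTo I) x, Fintype (f ⟶ g) := fun f g =>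
    Fintype.ofFinite _
  have : FinCategory (CostructuredArrow (discreteTo I) x) := {}
  infer_instance

/-- A free functor has free generators. -/
lemma nonempty_freeGenerators [Finite I] {P : I ⥤ FGModuleCat.{u} K} {V : I → FGModuleCat.{u} K}
    (h : IsFreeOn P V) : Nonempty (FreeGenerators P V) := by
  obtain ⟨-, α, hα⟩ := h
  -- The relevant comma categories are finite, so the extension is pointwise: `P(x)` is the colimit
  -- of `V` over the `b ≤ x`, a category with only identity morphisms.
  have H := Functor.isPointwiseLeftKanExtensionOfIsLeftKanExtension P α
  let c : ∀ (x : I) (M : FGModuleCat.{u} K) (f : ∀ b, b ≤ x → (V b ⟶ M)),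
      Cocone (CostructuredArrow.proj (discreteTo I) x ⋙ Discrete.functor V) := fun x M f =>
    { pt := M
      ι :=
        { app := fun j => f j.left.as (leOfHom j.hom)
          naturality := by
            rintro ⟨⟨i⟩, ⟨⟨⟩⟩, f⟩ ⟨⟨j⟩, ⟨⟨⟩⟩, g⟩ φ
            obtain rfl : i = j := Discrete.eq_of_hom φ.left
            obtain rfl : f = g := Subsingleton.elim _ _
            obtain rfl : φ = 𝟙 _ := CostructuredArrow.hom_ext _ _ (Subsingleton.elim _ _)
            exact (congrArg (· ≫ _) (CategoryTheory.Functor.map_id _ _)).trans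
              ((Category.id_comp _).trans (Category.comp_id _).symm) } }
  refine ⟨{
    gen := fun b => α.app ⟨b⟩
    desc := fun {x M} f => (H x).desc (c x M f)
    fac := fun {x M} f b h => ?_
    hom_ext := fun {x M f g} h => ?_ }⟩
  · exact (Category.assoc _ _ _).symm.trans ((H x).fac (c x M f)
      (CostructuredArrow.mk (Y := Discrete.mk b)
        (show (discreteTo I).obj ⟨b⟩ ⟶ x from homOfLE h)))
  · refine (H x).hom_ext ?_
    rintro ⟨⟨i⟩, ⟨⟨⟩⟩, φ⟩
    exact (Category.assoc _ _ _).trans ((h i (leOfHom φ)).trans (Category.assoc _ _ _).symm)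

/-- The free functor with given generators. -/
def free [Finite I] (V : I → FGModuleCat.{u} K) : I ⥤ FGModuleCat.{u} K :=
  (discreteTo I).leftKanExtension (Discrete.functor V)

lemma isFreeOn_free [Finite I] (V : I → FGModuleCat.{u} K) : IsFreeOn (free V) V :=
  ⟨Set.toFinite _, (discreteTo I).leftKanExtensionUnit (Discrete.functor V),
    inferInstanceAs (((discreteTo I).leftKanExtension (Discrete.functor V)).IsLeftKanExtension
      ((discreteTo I).leftKanExtensionUnit (Discrete.functor V)))⟩

namespace FreeGenerators

variable {P : I ⥤ FGModuleCat.{u} K} {V : I → FGModuleCat.{u} K} (e : FreeGenerators P V)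

/-- The natural transformation with given values on generators. -/
def lift {F : I ⥤ FGModuleCat.{u} K} (f : ∀ b, V b ⟶ F.obj b) : P ⟶ F where
  app x := e.desc fun b h => f b ≫ F.map (homOfLE h)
  naturality x y φ := by
    refine e.hom_ext fun b h => ?_
    have h' : b ≤ y := h.trans (leOfHom φ)
    have hc : P.map (homOfLE h) ≫ P.map φ = P.map (homOfLE h') := by
      rw [← P.map_comp]; rfl
    have hc' : F.map (homOfLE h) ≫ F.map φ = F.map (homOfLE h') := by
      rw [← F.map_comp]; rfl
    rw [← Category.assoc (P.map (homOfLE h)), hc, e.fac]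
    rw [← Category.assoc (P.map (homOfLE h)), ← Category.assoc, e.fac, Category.assoc, hc']

lemma gen_lift {F : I ⥤ FGModuleCat.{u} K} (f : ∀ b, V b ⟶ F.obj b) (b : I) :
    e.gen b ≫ (e.lift f).app b = f b := by
  have := e.fac (x := b) (fun b h => f b ≫ F.map (homOfLE h)) b le_rfl
  have h1 : P.map (homOfLE (le_refl b)) = 𝟙 _ := P.map_id b
  have h2 : F.map (homOfLE (le_refl b)) = 𝟙 _ := F.map_id b
  rw [h1, Category.id_comp, h2, Category.comp_id] at this
  exact this

lemma natTrans_ext {F : I ⥤ FGModuleCat.{u} K} {f g : P ⟶ F}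
    (h : ∀ b, e.gen b ≫ f.app b = e.gen b ≫ g.app b) : f = g := by
  ext1; funext x
  refine e.hom_ext fun b hb => ?_
  rw [f.naturality, g.naturality, ← Category.assoc, ← Category.assoc, h]

open Classical in
/-- The projection of `P(a)` to the generators at `a`. -/
def proj (a : I) : P.obj a ⟶ V a :=
  e.desc fun b _ => if h : b = a then eqToHom (congrArg V h) else 0

lemma gen_proj (a : I) : e.gen a ≫ e.proj a = 𝟙 _ := by
  classical
  have := e.fac (x := a) (fun b _ => if h : b = a then eqToHom (congrArg V h) else 0) a le_rfl
  have h1 : P.map (homOfLE (le_refl a)) = 𝟙 _ := P.map_id a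
  rw [h1, Category.id_comp] at this
  exact this.trans (by simp)

lemma map_proj {x a : I} (h : x < a) : P.map (homOfLE h.le) ≫ e.proj a = 0 := by
  refine e.hom_ext fun b hb => ?_
  have hc : P.map (homOfLE hb) ≫ P.map (homOfLE h.le) = P.map (homOfLE (hb.trans h.le)) := by
    rw [← P.map_comp]; rfl
  rw [← Category.assoc (P.map _), hc, proj, e.fac, dif_neg (hb.trans_lt h).ne, comp_zero,
    comp_zero]

end FreeGenerators

end Free

/-! ### The radical of a functor -/

section Radical

variable {K : Type u} [Field K] {I : Type w} [PartialOrder I]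

/-- The subspace of `F(a)` spanned by the images of the spaces `F(x)` with `x < a`. -/
def radical (F : I ⥤ FGModuleCat.{u} K) (a : I) : Submodule K (F.obj a) :=
  ⨆ x : Set.Iio a, LinearMap.range (F.map (homOfLE x.2.le)).hom.hom

lemma map_mem_radical (F : I ⥤ FGModuleCat.{u} K) {x a : I} (h : x < a) (v : F.obj x) :
    (F.map (homOfLE h.le)).hom.hom v ∈ radical F a :=
  Submodule.mem_iSup_of_mem (p := fun x : Set.Iio a =>
    LinearMap.range (F.map (homOfLE x.2.le)).hom.hom) ⟨x, h⟩ ⟨v, rfl⟩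

lemma radical_le {F : I ⥤ FGModuleCat.{u} K} {a : I} {W : Submodule K (F.obj a)} :
    radical F a ≤ W ↔ ∀ x (h : x < a) v, (F.map (homOfLE h.le)).hom.hom v ∈ W := by
  refine ⟨fun h x hx v => h (map_mem_radical F hx v), fun h => iSup_le fun x => ?_⟩
  rintro _ ⟨v, rfl⟩
  exact h x.1 x.2 v

lemma naturality_apply {F G : I ⥤ FGModuleCat.{u} K} (f : F ⟶ G) {x a : I} (h : x ≤ a)
    (v : F.obj x) : (f.app a).hom.hom ((F.map (homOfLE h)).hom.hom v) =
      (G.map (homOfLE h)).hom.hom ((f.app x).hom.hom v) := by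
  have := congrArg (fun g => g.hom.hom v) (f.naturality (homOfLE h))
  exact this

lemma app_mem_radical {F G : I ⥤ FGModuleCat.{u} K} (f : F ⟶ G) {a : I} {v : F.obj a}
    (h : v ∈ radical F a) : (f.app a).hom.hom v ∈ radical G a := by
  have : radical F a ≤ (radical G a).comap (f.app a).hom.hom := by
    rw [radical_le]
    intro x hx v
    rw [Submodule.mem_comap, naturality_apply]
    exact map_mem_radical G hx _
  exact this h

lemma radical_le_ker_iff {F : I ⥤ FGModuleCat.{u} K} {a : I} {M : FGModuleCat.{u} K}
    (φ : F.obj a ⟶ M) : radical F a ≤ LinearMap.ker φ.hom.hom ↔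
      ∀ x (h : x < a), F.map (homOfLE h.le) ≫ φ = 0 := by
  rw [radical_le]
  refine forall₂_congr fun x hx => ⟨fun h => ?_, fun h v => ?_⟩
  · ext v
    exact h v
  · exact congrArg (fun g => g.hom.hom v) h

namespace FreeGenerators

variable {P : I ⥤ FGModuleCat.{u} K} {V : I → FGModuleCat.{u} K} (e : FreeGenerators P V)

lemma proj_gen_apply (a : I) (w : V a) : (e.proj a).hom.hom ((e.gen a).hom.hom w) = w :=
  congrArg (fun g => g.hom.hom w) (e.gen_proj a)

lemma radical_le_ker_proj (a : I) : radical P a ≤ LinearMap.ker (e.proj a).hom.hom :=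
  (radical_le_ker_iff _).2 fun _ h => e.map_proj h

/-- The quotient map by this sum kills every generator at `b ≤ a`: for `b = a` by the first summand,
for `b < a` by the radical. Hence it is zero. -/
lemma range_gen_sup_radical (a : I) :
    LinearMap.range (e.gen a).hom.hom ⊔ radical P a = ⊤ := by
  set W := LinearMap.range (e.gen a).hom.hom ⊔ radical P a with hW
  let q : P.obj a ⟶ FGModuleCat.of K (P.obj a ⧸ W) := FGModuleCat.ofHom W.mkQ
  have hq : ∀ v, q.hom.hom v = 0 ↔ v ∈ W := fun v => Submodule.Quotient.mk_eq_zero W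
  have h0 : q = 0 := by
    refine e.hom_ext fun b hb => ?_
    ext v
    change q.hom.hom ((P.map (homOfLE hb)).hom.hom ((e.gen b).hom.hom v)) = 0
    rw [hq]
    rcases hb.eq_or_lt with rfl | hlt
    · have : P.map (homOfLE hb) = 𝟙 _ := P.map_id b
      rw [this]
      exact Submodule.mem_sup_left ⟨v, rfl⟩
    · exact Submodule.mem_sup_right (map_mem_radical P hlt _)
  rw [eq_top_iff]
  intro v _
  rw [← hq, h0]
  rfl

lemma exists_decomposition {a : I} (v : P.obj a) :
    ∃ w : V a, ∃ r ∈ radical P a, v = (e.gen a).hom.hom w + r := by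
  have hv : v ∈ LinearMap.range (e.gen a).hom.hom ⊔ radical P a := by
    rw [e.range_gen_sup_radical]; trivial
  obtain ⟨_, ⟨w, rfl⟩, r, hr, h⟩ := Submodule.mem_sup.1 hv
  exact ⟨w, r, hr, h.symm⟩

end FreeGenerators

end Radical

/-! ### Covers and Nakayama's lemma -/

section Cover

variable {K : Type u} [Field K] {I : Type w} [PartialOrder I]

lemma epi_iff_surjective {M N : FGModuleCat.{u} K} (f : M ⟶ N) :
    Epi f ↔ Function.Surjective f.hom.hom := by
  refine ⟨fun h => ?_, fun h => ?_⟩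
  · have : Epi ((forget₂ (FGModuleCat K) (ModuleCat.{u} K)).map f) := inferInstance
    exact (ModuleCat.epi_iff_surjective _).1 this
  · have : Epi ((forget₂ (FGModuleCat K) (ModuleCat.{u} K)).map f) :=
      (ModuleCat.epi_iff_surjective _).2 h
    exact (forget₂ (FGModuleCat K) (ModuleCat.{u} K)).epi_of_epi_map this

lemma mono_iff_injective {M N : FGModuleCat.{u} K} (f : M ⟶ N) :
    Mono f ↔ Function.Injective f.hom.hom := by
  refine ⟨fun h => ?_, fun h => ?_⟩
  · have : Mono ((forget₂ (FGModuleCat K) (ModuleCat.{u} K)).map f) := inferInstance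
    exact (ModuleCat.mono_iff_injective _).1 this
  · have : Mono ((forget₂ (FGModuleCat K) (ModuleCat.{u} K)).map f) :=
      (ModuleCat.mono_iff_injective _).2 h
    exact (forget₂ (FGModuleCat K) (ModuleCat.{u} K)).mono_of_mono_map this

lemma epi_iff_forall_surjective {F G : I ⥤ FGModuleCat.{u} K} (f : F ⟶ G) :
    Epi f ↔ ∀ a, Function.Surjective (f.app a).hom.hom := by
  rw [NatTrans.epi_iff_epi_app]
  exact forall_congr' fun a => epi_iff_surjective _

lemma isIso_of_epi_endo {F : I ⥤ FGModuleCat.{u} K} (f : F ⟶ F) [Epi f] : IsIso f := by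
  rw [NatTrans.isIso_iff_isIso_app]
  intro a
  have h := (epi_iff_forall_surjective f).1 inferInstance a
  have : Epi (f.app a) := (epi_iff_surjective _).2 h
  have : Mono (f.app a) := (mono_iff_injective _).2 (LinearMap.injective_iff_surjective.2 h)
  exact isIso_of_mono_of_epi _

/-- An epimorphism whose kernel is contained in the radical. -/
structure IsCover {P F : I ⥤ FGModuleCat.{u} K} (π : P ⟶ F) : Prop where
  epi : Epi π
  mem_radical : ∀ a v, (π.app a).hom.hom v = 0 → v ∈ radical P a

/-- If `1 - s` is invertible for all endomorphisms `s` of a free functor `P` with `s ≫ g = 0`, then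
the kernel of `g` lies in the radical. -/
lemma FreeGenerators.mem_radical {P F : I ⥤ FGModuleCat.{u} K} {V : I → FGModuleCat.{u} K}
    (e : FreeGenerators P V) (g : P ⟶ F) (h : ∀ s : P ⟶ P, s ≫ g = 0 → IsIso (𝟙 P - s))
    (a : I) (v : P.obj a) (hv : (g.app a).hom.hom v = 0) : v ∈ radical P a := by
  classical
  obtain ⟨w, r, hr, hvw⟩ := e.exists_decomposition v
  by_cases hw : w = 0
  · rw [hvw, hw, map_zero, zero_add]
    exact hr
  -- A functional with `l w ≠ 0` gives a rank-one map `t` sending `w` to `v`, with image in the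
  -- kernel of `g`. Extended by zero on the other generators, it is the endomorphism `s`.
  obtain ⟨l, hl⟩ := Module.Projective.exists_dual_ne_zero K hw
  let t : V a ⟶ P.obj a := FGModuleCat.ofHom ((l w)⁻¹ • l.smulRight v)
  have ht : ∀ x, t.hom.hom x = ((l w)⁻¹ * l x) • v := fun x => by
    change (l w)⁻¹ • (l x • v) = _
    rw [smul_smul]
  let s : P ⟶ P := e.lift fun b =>
    if hb : b = a then eqToHom (by rw [hb]) ≫ t ≫ eqToHom (by rw [hb]) else 0
  have hs : e.gen a ≫ s.app a = t := by
    rw [e.gen_lift]; simp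
  have hsg : s ≫ g = 0 := by
    refine e.natTrans_ext fun b => ?_
    have h1 : e.gen b ≫ (s ≫ g).app b = (e.gen b ≫ s.app b) ≫ g.app b := by
      rw [Category.assoc]; rfl
    rw [h1]
    by_cases hb : b = a
    · subst hb
      rw [hs]
      ext x
      change (g.app b).hom.hom (t.hom.hom x) = 0
      rw [ht, map_smul, hv, smul_zero]
    · rw [e.gen_lift, dif_neg hb, zero_comp]
      exact comp_zero.symm
  have := h s hsg
  have hsv : (s.app a).hom.hom v = v + (s.app a).hom.hom r := by
    conv_lhs => rw [hvw]
    rw [map_add]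
    congr 1
    have : (s.app a).hom.hom ((e.gen a).hom.hom w) = t.hom.hom w :=
      congrArg (fun g => g.hom.hom w) hs
    rw [this, ht, inv_mul_cancel₀ hl, one_smul]
  -- Here `(1 - s) v = -s r` lies in the radical, and the inverse of `1 - s`, being natural,
  -- preserves the radical.
  have h1 : ((𝟙 P - s).app a).hom.hom v ∈ radical P a := by
    have : ((𝟙 P - s).app a).hom.hom v = v - (s.app a).hom.hom v := rfl
    rw [this, hsv, sub_add_cancel_left]
    exact neg_mem (app_mem_radical s hr)
  have h2 := app_mem_radical (inv (𝟙 P - s)) h1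
  have h3 : ((inv (𝟙 P - s)).app a).hom.hom (((𝟙 P - s).app a).hom.hom v) = v :=
    congrArg (fun g => (g.app a).hom.hom v) (IsIso.hom_inv_id (𝟙 P - s))
  rwa [h3] at h2

variable [Finite I]

/-- Nakayama's lemma, by induction on `a`: if `W` is everything strictly below `a`, then `W a`
contains the radical at `a`. -/
lemma eq_top_of_sup_radical {F : I ⥤ FGModuleCat.{u} K} (W : ∀ a, Submodule K (F.obj a))
    (hW : ∀ {x a : I} (h : x ≤ a) (v : F.obj x), v ∈ W x → (F.map (homOfLE h)).hom.hom v ∈ W a)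
    (h : ∀ a, W a ⊔ radical F a = ⊤) (a : I) : W a = ⊤ := by
  induction a using WellFoundedLT.induction with
  | ind a ih =>
    rw [← h a, eq_comm, sup_eq_left, radical_le]
    intro x hx v
    refine hW hx.le v ?_
    rw [ih x hx]
    trivial

lemma IsCover.epi_of_epi_comp {P F X : I ⥤ FGModuleCat.{u} K} {π : P ⟶ F} (hπ : IsCover π)
    (f : X ⟶ P) (h : Epi (f ≫ π)) : Epi f := by
  rw [epi_iff_forall_surjective] at h ⊢
  intro a
  rw [← LinearMap.range_eq_top]
  refine eq_top_of_sup_radical (fun a => LinearMap.range (f.app a).hom.hom) ?_ ?_ a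
  · rintro x a h _ ⟨v, rfl⟩
    exact ⟨_, naturality_apply f h v⟩
  · intro a
    rw [eq_top_iff]
    intro v _
    obtain ⟨w, hw⟩ := h a ((π.app a).hom.hom v)
    have hw' : (π.app a).hom.hom ((f.app a).hom.hom w) = (π.app a).hom.hom v := hw
    rw [← add_sub_cancel ((f.app a).hom.hom w) v]
    refine Submodule.add_mem_sup ⟨w, rfl⟩ (hπ.mem_radical a _ ?_)
    rw [map_sub, hw', sub_self]

/-- The generators at `a` are a complement of the radical of `F` at `a`. Nakayama gives
surjectivity; a kernel element has generator part in both the complement and the radical, so that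
part vanishes. -/
lemma exists_isCover (F : I ⥤ FGModuleCat.{u} K) :
    ∃ (V : I → FGModuleCat.{u} K) (π : free V ⟶ F), IsCover π := by
  choose C hC using fun a => Submodule.exists_isCompl (radical F a)
  let V : I → FGModuleCat.{u} K := fun a => FGModuleCat.of K (C a)
  obtain ⟨e⟩ := nonempty_freeGenerators (isFreeOn_free V)
  let i : ∀ a, V a ⟶ F.obj a := fun a => FGModuleCat.ofHom (C a).subtype
  let π : free V ⟶ F := e.lift i
  have hπ : ∀ (a : I) (w : V a), (π.app a).hom.hom ((e.gen a).hom.hom w) = w.1 := fun a w =>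
    congrArg (fun g => g.hom.hom w) (e.gen_lift i a)
  refine ⟨V, π, ?_, fun a v hv => ?_⟩
  · rw [epi_iff_forall_surjective]
    intro a
    rw [← LinearMap.range_eq_top]
    refine eq_top_of_sup_radical (fun a => LinearMap.range (π.app a).hom.hom) ?_ (fun a => ?_) a
    · rintro x a h _ ⟨v, rfl⟩
      exact ⟨_, naturality_apply π h v⟩
    · rw [eq_top_iff, ← (hC a).sup_eq_top, sup_comm]
      refine sup_le_sup_right (fun w hw => ?_) _
      exact ⟨_, hπ a ⟨w, hw⟩⟩
  · obtain ⟨w, r, hr, rfl⟩ := e.exists_decomposition v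
    have hr' := app_mem_radical π hr
    rw [map_add, hπ] at hv
    have h1 : w.1 ∈ radical F a := by
      rw [eq_neg_of_add_eq_zero_left hv]
      exact neg_mem hr'
    have h2 : w = 0 := Subtype.ext ((Submodule.disjoint_def.1 (hC a).disjoint) w.1 h1 w.2)
    rw [h2, map_zero, zero_add]
    exact hr

end Cover

/-! ### Existence of minimal resolutions -/

section Existence

variable {K : Type u} [Field K] {I : Type w} [PartialOrder I] [Finite I]

/-- The generators of a chosen cover. -/
def coverGenerators (F : I ⥤ FGModuleCat.{u} K) : I → FGModuleCat.{u} K :=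
  (exists_isCover F).choose

/-- A chosen cover of `F` by a free functor. -/
def cover (F : I ⥤ FGModuleCat.{u} K) : free (coverGenerators F) ⟶ F :=
  (exists_isCover F).choose_spec.choose

lemma isCover_cover (F : I ⥤ FGModuleCat.{u} K) : IsCover (cover F) :=
  (exists_isCover F).choose_spec.choose_spec

instance epi_cover (F : I ⥤ FGModuleCat.{u} K) : Epi (cover F) := (isCover_cover F).epi

/-- The iterated syzygies of `G`. -/
def syzygy (G : I ⥤ FGModuleCat.{u} K) : ℕ → (I ⥤ FGModuleCat.{u} K)
  | 0 => G
  | n + 1 => kernel (cover (syzygy G n))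

/-- The inclusion of a syzygy into the preceding free functor. -/
def syzygyι (G : I ⥤ FGModuleCat.{u} K) (n : ℕ) :
    syzygy G (n + 1) ⟶ free (coverGenerators (syzygy G n)) :=
  kernel.ι (cover (syzygy G n))

instance (G : I ⥤ FGModuleCat.{u} K) (n : ℕ) : Mono (syzygyι G n) :=
  inferInstanceAs (Mono (kernel.ι _))

lemma syzygyι_cover (G : I ⥤ FGModuleCat.{u} K) (n : ℕ) :
    syzygyι G n ≫ cover (syzygy G n) = 0 :=
  kernel.condition _

/-- A map into a syzygy. -/
def syzygyLift (G : I ⥤ FGModuleCat.{u} K) (n : ℕ) {A : I ⥤ FGModuleCat.{u} K}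
    (x : A ⟶ free (coverGenerators (syzygy G n))) (h : x ≫ cover (syzygy G n) = 0) :
    A ⟶ syzygy G (n + 1) :=
  kernel.lift (cover (syzygy G n)) x h

lemma syzygyLift_ι (G : I ⥤ FGModuleCat.{u} K) (n : ℕ) {A : I ⥤ FGModuleCat.{u} K}
    (x : A ⟶ free (coverGenerators (syzygy G n))) (h : x ≫ cover (syzygy G n) = 0) :
    syzygyLift G n x h ≫ syzygyι G n = x :=
  kernel.lift_ι _ _ _

/-- The monomorphism `j` is the identity at the augmentation and the inclusion of a syzygy in higher
degrees. -/
lemma exact_syzygy (G : I ⥤ FGModuleCat.{u} K) (n : ℕ) {Y : I ⥤ FGModuleCat.{u} K}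
    (j : syzygy G n ⟶ Y) [Mono j] (w) :
    (ShortComplex.mk (cover (syzygy G (n + 1)) ≫ syzygyι G n)
      (cover (syzygy G n) ≫ j) w).Exact := by
  rw [ShortComplex.exact_iff_exact_up_to_refinements]
  intro A x hx
  dsimp only at x hx ⊢
  have hx' : x ≫ cover (syzygy G n) = 0 := by
    rw [← cancel_mono j, Category.assoc, zero_comp]
    exact hx
  obtain ⟨A', p, hp, y, hy⟩ := surjective_up_to_refinements_of_epi (cover (syzygy G (n + 1)))
    (syzygyLift G n x hx')
  refine ⟨A', p, hp, y, ?_⟩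
  rw [← Category.assoc y, ← hy, Category.assoc, syzygyLift_ι]

/-- The underlying complex of the minimal resolution of `G`. -/
def minimalComplex (G : I ⥤ FGModuleCat.{u} K) : ChainComplex (I ⥤ FGModuleCat.{u} K) ℕ :=
  ChainComplex.of (fun n => free (coverGenerators (syzygy G n)))
    (fun n => cover (syzygy G (n + 1)) ≫ syzygyι G n) fun n => by
      rw [Category.assoc, ← Category.assoc (syzygyι G (n + 1)), syzygyι_cover, zero_comp,
        comp_zero]

lemma minimalComplex_d (G : I ⥤ FGModuleCat.{u} K) (n : ℕ) :
    (minimalComplex G).d (n + 1) n = cover (syzygy G (n + 1)) ≫ syzygyι G n :=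
  ChainComplex.of_d (fun n => free (coverGenerators (syzygy G n)))
    (fun n => cover (syzygy G (n + 1)) ≫ syzygyι G n) n

lemma cover_syzygyι_cover (G : I ⥤ FGModuleCat.{u} K) (n : ℕ) :
    (cover (syzygy G (n + 1)) ≫ syzygyι G n) ≫ cover (syzygy G n) = 0 := by
  rw [Category.assoc, syzygyι_cover, comp_zero]

lemma exact_mk_of_eq {C : Type*} [Category* C] [HasZeroMorphisms C] {A B D : C} {f f' : A ⟶ B}
    {g g' : B ⟶ D} (hf : f = f') (hg : g = g') (w : f ≫ g = 0) (w' : f' ≫ g' = 0)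
    (h : (ShortComplex.mk f g w).Exact) : (ShortComplex.mk f' g' w').Exact := by
  subst hf hg
  exact h

/-- The minimal resolution of `G`. -/
def minimalResolution (G : I ⥤ FGModuleCat.{u} K) : Resolution G ⊤ where
  complex := minimalComplex G
  free i _ := ⟨_, isFreeOn_free (coverGenerators (syzygy G i))⟩
  isZero i h := absurd h (by simp)
  aug := cover G
  d_aug := (congrArg (· ≫ cover G) (minimalComplex_d G 0)).trans (cover_syzygyι_cover G 0)
  epi_aug := epi_cover G
  exact_zero _ := exact_mk_of_eq (minimalComplex_d G 0).symm (Category.comp_id _) _ _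
    (exact_syzygy G 0 (𝟙 _) (by rw [Category.comp_id, cover_syzygyι_cover]))
  exact_succ i _ := by
    rw [HomologicalComplex.exactAt_iff' _ (i + 2) (i + 1) i (by simp) (by simp)]
    exact exact_mk_of_eq (minimalComplex_d G (i + 1)).symm (minimalComplex_d G i).symm _ _
      (exact_syzygy G (i + 1) (syzygyι G i) (by
        rw [← Category.assoc, cover_syzygyι_cover, zero_comp]))

/-- By induction, `f n` lies over an automorphism of the `n`-th syzygy. Then `f n` is epi because
the cover is essential, hence an isomorphism by dimension, and it restricts to an automorphism of
the kernel, the next syzygy. -/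
lemma isIso_of_comm (G : I ⥤ FGModuleCat.{u} K)
    (f : ∀ n, free (coverGenerators (syzygy G n)) ⟶ free (coverGenerators (syzygy G n)))
    (h0 : f 0 ≫ cover (syzygy G 0) = cover (syzygy G 0))
    (hf : ∀ n, f (n + 1) ≫ cover (syzygy G (n + 1)) ≫ syzygyι G n =
      (cover (syzygy G (n + 1)) ≫ syzygyι G n) ≫ f n) (n : ℕ) : IsIso (f n) := by
  have step : ∀ n (ψ : syzygy G n ⟶ syzygy G n), IsIso ψ →
      f n ≫ cover (syzygy G n) = cover (syzygy G n) ≫ ψ → IsIso (f n) := by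
    intro n ψ hψ h
    have : Epi (f n ≫ cover (syzygy G n)) := by
      rw [h]
      exact epi_comp _ _
    have : Epi (f n) := (isCover_cover (syzygy G n)).epi_of_epi_comp (f n) this
    exact isIso_of_epi_endo (f n)
  have key : ∀ n, ∃ ψ : syzygy G n ⟶ syzygy G n, IsIso ψ ∧
      f n ≫ cover (syzygy G n) = cover (syzygy G n) ≫ ψ := by
    intro n
    induction n with
    | zero => exact ⟨𝟙 _, inferInstance, by rw [Category.comp_id]; exact h0⟩
    | succ n ih =>
      obtain ⟨ψ, hψ, h⟩ := ih
      have := step n ψ hψ h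
      obtain ⟨ψ', hψ', h1⟩ : ∃ ψ' : syzygy G (n + 1) ⟶ syzygy G (n + 1), IsIso ψ' ∧
          ψ' ≫ syzygyι G n = syzygyι G n ≫ f n :=
        ⟨kernel.map _ _ (f n) ψ h.symm,
          (kernel.mapIso _ _ (asIso (f n)) (asIso ψ) h.symm).isIso_hom, kernel.lift_ι _ _ _⟩
      refine ⟨ψ', hψ', ?_⟩
      rw [← cancel_mono (syzygyι G n), Category.assoc, Category.assoc, hf, h1, Category.assoc]
  obtain ⟨ψ, hψ, h⟩ := key n
  exact step n ψ hψ h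

lemma isMinimal_minimalResolution (G : I ⥤ FGModuleCat.{u} K) :
    (minimalResolution G).IsMinimal := by
  intro φ hφ
  have : ∀ n, IsIso (φ.f n) := isIso_of_comm G φ.f hφ fun n => by
    have h := φ.comm (n + 1) n
    have h' : (minimalResolution G).complex.d (n + 1) n = _ := minimalComplex_d G n
    rw [h'] at h
    exact h
  exact HomologicalComplex.Hom.isIso_of_components φ

end Existence

/-! ### Projectivity, and exactness of the augmented complex -/

section Minimal

variable {K : Type u} [Field K] {I : Type w} [PartialOrder I]

lemma FreeGenerators.projective {P : I ⥤ FGModuleCat.{u} K} {V : I → FGModuleCat.{u} K}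
    (e : FreeGenerators P V) : Projective P := by
  refine ⟨fun {E X} f g hg => ?_⟩
  rw [epi_iff_forall_surjective] at hg
  choose t ht using fun b => Module.projective_lifting_property (g.app b).hom.hom
    (e.gen b ≫ f.app b).hom.hom (hg b)
  let t' : ∀ b, V b ⟶ E.obj b := fun b => FGModuleCat.ofHom (t b)
  refine ⟨e.lift t', e.natTrans_ext fun b => ?_⟩
  have h1 : e.gen b ≫ (e.lift t' ≫ g).app b = (e.gen b ≫ (e.lift t').app b) ≫ g.app b := by
    rw [Category.assoc]; rfl
  rw [h1, e.gen_lift]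
  ext x
  exact congrArg (fun l => l x) (ht b)

/-- The augmented complex of a resolution. -/
def _root_.Resolution.augmented {F : I ⥤ FGModuleCat.{u} K} {n : ℕ∞} (P : Resolution F n) :
    ChainComplex (I ⥤ FGModuleCat.{u} K) ℕ :=
  P.complex.augment P.aug P.d_aug

/-- The augmented complex has `F` in degree `0` and `P_i` in degree `i + 1`, so exactness at `P_0`
and at later terms takes one form. -/
lemma _root_.Resolution.exact {F : I ⥤ FGModuleCat.{u} K} {n : ℕ∞} (P : Resolution F n) (i : ℕ)
    (hi : ((i + 1 : ℕ) : ℕ∞) < n) :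
    (ShortComplex.mk (P.augmented.d (i + 2) (i + 1))
      (P.augmented.d (i + 1) i) (HomologicalComplex.d_comp_d _ _ _ _)).Exact := by
  cases i with
  | zero => exact P.exact_zero (by simpa using hi)
  | succ i =>
    have := P.exact_succ i hi
    rw [HomologicalComplex.exactAt_iff' _ (i + 2) (i + 1) i (by simp) (by simp)] at this
    exact this

end Minimal

/-! ### Null-homotopic endomorphisms -/

section ChainMaps

variable {C : Type*} [Category* C] [Preadditive C]

/-- A null-homotopic endomorphism with a single non-zero component of the homotopy. -/
lemma exists_nullHomotopic (A : ChainComplex C ℕ) (i : ℕ) (s : A.X i ⟶ A.X (i + 1)) :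
    ∃ ψ : A ⟶ A, (∀ {F : C} (g : A.X 0 ⟶ F), A.d 1 0 ≫ g = 0 → ψ.f 0 ≫ g = 0) ∧
      ψ.f i = s ≫ A.d (i + 1) i := by
  let h : ∀ j k, (ComplexShape.down ℕ).Rel k j → (A.X j ⟶ A.X k) := fun j k hjk =>
    if hj : j = i then eqToHom (by rw [hj]) ≫ s ≫
      eqToHom (by rw [← hj]; exact congrArg A.X hjk) else 0
  have hi : ∀ hii, h i (i + 1) hii = s := fun _ => by simp [h]
  refine ⟨Homotopy.nullHomotopicMap' h, fun g hg => ?_, ?_⟩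
  -- In degree `0` a null-homotopic map factors through `A.d 1 0` on the right, so `g` kills it.
  · rw [Homotopy.nullHomotopicMap'_f_of_not_rel_left (c := ComplexShape.down ℕ) (k₁ := 1)
      (k₀ := 0) (by simp) (by simp), Category.assoc, hg, comp_zero]
  · cases i with
    | zero =>
      rw [Homotopy.nullHomotopicMap'_f_of_not_rel_left (c := ComplexShape.down ℕ) (k₁ := 1)
        (k₀ := 0) (by simp) (by simp), hi (by simp)]
    | succ i =>
      rw [Homotopy.nullHomotopicMap'_f (c := ComplexShape.down ℕ) (k₂ := i + 2) (k₁ := i + 1)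
        (k₀ := i) (by simp) (by simp), hi (by simp)]
      simp [h]

end ChainMaps

/-! ### Minimal resolutions consist of covers -/

section Minimal

variable {K : Type u} [Field K] {I : Type w} [PartialOrder I]

/-- `V` is computed by `i + 1` steps of a resolution of `F` by covers. -/
inductive HasBetti : (I ⥤ FGModuleCat.{u} K) → ℕ → (I → FGModuleCat.{u} K) → Prop
  | zero {P F : I ⥤ FGModuleCat.{u} K} {V : I → FGModuleCat.{u} K} (e : FreeGenerators P V)
      (π : P ⟶ F) (hπ : IsCover π) : HasBetti F 0 V
  | succ {Z P F : I ⥤ FGModuleCat.{u} K} {W V : I → FGModuleCat.{u} K} {i : ℕ}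
      (e : FreeGenerators P W) (ι : Z ⟶ P) (π : P ⟶ F) (hπ : IsCover π) (w : ι ≫ π = 0)
      (h : (ShortComplex.mk ι π w).ShortExact) (hZ : HasBetti Z i V) : HasBetti F (i + 1) V

open Classical in
-- It suffices to extend `1 - s` to a chain map over `F`. If `i + 1 < n`, projectivity lifts `s`
-- through the next differential, and `1` minus a null-homotopic map works. If `i` is the top
-- degree, changing the identity in degree `i` alone already gives a chain map.
lemma _root_.Resolution.IsMinimal.isIso_one_sub {F : I ⥤ FGModuleCat.{u} K} {n : ℕ∞}
    {P : Resolution F n} (hP : P.IsMinimal) (i : ℕ) (hi : (i : ℕ∞) < n)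
    (hproj : Projective (P.complex.X i))
    (s : P.complex.X i ⟶ P.complex.X i) (hs : s ≫ P.augmented.d (i + 1) i = 0) :
    IsIso (𝟙 _ - s) := by
  suffices ∃ φ : P.complex ⟶ P.complex, φ.f 0 ≫ P.aug = P.aug ∧ φ.f i = 𝟙 _ - s by
    obtain ⟨φ, h1, h2⟩ := this
    have := hP φ h1
    rw [← h2]
    infer_instance
  by_cases hn : ((i + 1 : ℕ) : ℕ∞) < n
  · obtain ⟨s', hs'⟩ : ∃ s' : P.complex.X i ⟶ P.complex.X (i + 1),
        s' ≫ P.complex.d (i + 1) i = s := by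
      have hex := P.exact i hn
      have : Projective (P.augmented.X (i + 1)) := hproj
      refine ⟨hex.liftFromProjective (P := P.complex.X i) s hs, ?_⟩
      have := hex.liftFromProjective_comp (P := P.complex.X i) s hs
      refine Eq.trans ?_ this
      exact congrArg _ (P.complex.augment_d_succ_succ P.aug P.d_aug (i + 1) i).symm
    obtain ⟨ψ, h0, h1⟩ := exists_nullHomotopic P.complex i s'
    refine ⟨𝟙 _ - ψ, ?_, ?_⟩
    · rw [HomologicalComplex.sub_f_apply, Preadditive.sub_comp, h0 _ P.d_aug, sub_zero]
      exact Category.id_comp _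
    · rw [HomologicalComplex.sub_f_apply, h1, hs']
      rfl
  · have hz : ∀ j, i < j → IsZero (P.complex.X j) := fun j hj =>
      P.isZero j ((not_lt.1 hn).trans (by exact_mod_cast hj))
    let φ : P.complex ⟶ P.complex :=
      { f := fun j => if h : j = i then 𝟙 _ - eqToHom (by rw [h]) ≫ s ≫ eqToHom (by rw [h])
          else 𝟙 _
        comm' := ?_ }
    · refine ⟨φ, ?_, by simp [φ]⟩
      by_cases h : i = 0
      · subst h
        have hs' : s ≫ P.aug = 0 := hs
        simp [φ, hs']
      · simp [φ, Ne.symm h]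
    · rintro j k (rfl : k + 1 = j)
      by_cases h1 : k = i
      · exact (hz _ (by omega)).eq_of_src _ _
      · by_cases h2 : k + 1 = i
        · subst h2
          have hs' : s ≫ P.complex.d (k + 1) k = 0 := by
            have := P.complex.augment_d_succ_succ P.aug P.d_aug (k + 1) k
            rw [← this]
            exact hs
          simp [hs']
        · simp [h1, h2]

lemma HasBetti.of_isMinimal [Finite I] {F : I ⥤ FGModuleCat.{u} K} {n : ℕ∞} {P : Resolution F n}
    (hP : P.IsMinimal) {i : ℕ} (hi : (i : ℕ∞) < n) {V : I → FGModuleCat.{u} K}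
    (hV : IsFreeOn (P.complex.X i) V) : HasBetti F i V := by
  -- Whenever a differential factors as an epi `π` followed by a mono, `π` is a cover.
  have hcov : ∀ (j : ℕ), (j : ℕ∞) < n → ∀ {Z : I ⥤ FGModuleCat.{u} K}
      (π : P.augmented.X (j + 1) ⟶ Z) (_ : Epi π) (k : Z ⟶ P.augmented.X j) (_ : Mono k)
      (_ : π ≫ k = P.augmented.d (j + 1) j), IsCover π := by
    intro j hj Z π hπ k hk h
    obtain ⟨W, hW⟩ := P.free j hj
    obtain ⟨e⟩ := nonempty_freeGenerators hW
    refine ⟨hπ, fun a v hv => e.mem_radical (F := Z) π (fun s hs => ?_) a v hv⟩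
    refine hP.isIso_one_sub j hj e.projective s ?_
    rw [← h]
    exact (Category.assoc _ _ _).symm.trans ((congrArg (· ≫ k) hs).trans zero_comp)
  have hid : Mono (𝟙 F) := inferInstance
  -- Here `Z` is the `j`-th syzygy, with `m` steps left to reach `P_i`; the start is `Z = F` at `j =
  -- 0`.
  suffices key : ∀ (m j : ℕ), j + m = i → ∀ {Z : I ⥤ FGModuleCat.{u} K}
      (π : P.augmented.X (j + 1) ⟶ Z) (_ : Epi π) (k : Z ⟶ P.augmented.X j) (_ : Mono k)
      (_ : π ≫ k = P.augmented.d (j + 1) j), HasBetti Z m V from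
    key i 0 (zero_add i) (Z := F) P.aug P.epi_aug (𝟙 F) hid
      (Category.comp_id _)
  intro m
  induction m with
  | zero =>
    rintro j rfl Z π hπ k hk h
    obtain ⟨e⟩ := nonempty_freeGenerators hV
    exact .zero e π (hcov j hi π hπ k hk h)
  | succ m ih =>
    rintro j hj Z π hπ k hk h
    have hj1 : ((j + 1 : ℕ) : ℕ∞) < n := lt_of_le_of_lt (by exact_mod_cast (by omega)) hi
    have hj0 : (j : ℕ∞) < n := lt_of_le_of_lt (by exact_mod_cast (by omega)) hi
    obtain ⟨W, hW⟩ := P.free j hj0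
    obtain ⟨e⟩ := nonempty_freeGenerators hW
    have hw : P.augmented.d (j + 2) (j + 1) ≫ π = 0 := by
      rw [← cancel_mono k, Category.assoc, h, zero_comp, HomologicalComplex.d_comp_d]
    have hex : (ShortComplex.mk (P.augmented.d (j + 2) (j + 1)) π hw).Exact :=
      (ShortComplex.exact_iff_of_epi_of_isIso_of_mono
        (S₁ := ShortComplex.mk (P.augmented.d (j + 2) (j + 1)) π hw)
        (S₂ := ShortComplex.mk (P.augmented.d (j + 2) (j + 1)) (P.augmented.d (j + 1) j)
          (HomologicalComplex.d_comp_d _ _ _ _))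
        { τ₁ := 𝟙 _, τ₂ := 𝟙 _, τ₃ := k, comm₂₃ := (Category.id_comp _).trans h.symm }).2
        (P.exact j hj1)
    refine .succ (P := P.augmented.X (j + 1)) e (kernel.ι π) π (hcov j hj0 π hπ k hk h)
      (kernel.condition π)
      { exact := ShortComplex.exact_kernel π, mono_f := inferInstance, epi_g := hπ } ?_
    exact ih (j + 1) (by omega) (kernel.lift π _ hw) hex.epi_kernelLift (kernel.ι π)
      inferInstance (kernel.lift_ι _ _ _)

end Minimal

/-! ### Functoriality of the Koszul complex -/

section Functoriality

variable {K : Type u} [Field K] {I : Type w} [PartialOrder I] [Finite I]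

/-- The map of colimits induced by a natural transformation. -/
def colimOnMap {G G' : I ⥤ FGModuleCat.{u} K} (f : G ⟶ G') (U : Set I) :
    colimOn G U ⟶ colimOn G' U :=
  Limits.colimMap (Functor.whiskerLeft (Subtype.mono_coe (· ∈ U)).functor f)

lemma inj_colimOnMap {G G' : I ⥤ FGModuleCat.{u} K} (f : G ⟶ G') (U : Set I) (x : U) :
    inj G U x ≫ colimOnMap f U = f.app x.1 ≫ inj G' U x :=
  ι_colimMap _ _

variable (G : I ⥤ FGModuleCat.{u} K) (a : I)

/-- The map from `G(x)` to the summand indexed by `S`, where `x` lies below `S`. -/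
def inclAt {k : ℕ} (S : Index a (k + 1)) (x : below S.1) : G.obj x.1 ⟶ X G a (k + 1) :=
  inj G (below S.1) x ≫ incl G a S

lemma map_inclAt {k : ℕ} (S : Index a (k + 1)) {x y : below S.1} (h : x.1 ≤ y.1) :
    G.map (homOfLE h) ≫ inclAt G a S y = inclAt G a S x := by
  rw [inclAt, ← Category.assoc, map_inj, inclAt]

variable {G a} in
lemma hom_ext_inclAt {k : ℕ} {M : FGModuleCat.{u} K} {f g : X G a (k + 1) ⟶ M}
    (h : ∀ S x, inclAt G a S x ≫ f = inclAt G a S x ≫ g) : f = g := by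
  refine X_hom_ext G a fun S => colimit.hom_ext fun x => ?_
  have := h S x
  rw [inclAt, Category.assoc, Category.assoc] at this
  exact this

/-- The map out of the `(k + 1)`-st term with given restrictions to the spaces `G(x)`. -/
def descAt {k : ℕ} {M : FGModuleCat.{u} K}
    (f : ∀ (S : Index a (k + 1)) (x : below S.1), G.obj x.1 ⟶ M)
    (hf : ∀ S (x y : below S.1) (h : x.1 ≤ y.1), G.map (homOfLE h) ≫ f S y = f S x) :
    X G a (k + 1) ⟶ M :=
  desc G a fun S => colimit.desc (restrict G (below S.1))
    { pt := M
      ι :=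
        { app := fun x => f S x
          naturality := fun x y φ => (hf S x y (leOfHom φ)).trans (Category.comp_id _).symm } }

lemma inclAt_descAt {k : ℕ} {M : FGModuleCat.{u} K}
    (f : ∀ (S : Index a (k + 1)) (x : below S.1), G.obj x.1 ⟶ M) (hf) (S : Index a (k + 1))
    (x : below S.1) : inclAt G a S x ≫ descAt G a f hf = f S x := by
  rw [inclAt, Category.assoc, descAt, incl_desc]
  exact colimit.ι_desc _ _

variable (prec : parents a → parents a → Prop)

lemma inclAt_d_zero (S : Index a 1) (x : below S.1) :
    inclAt G a S x ≫ d G a prec 0 = G.map (homOfLE (le_of_mem_below S x.2)) := by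
  rw [inclAt, Category.assoc, incl_d_zero]
  exact inj_colimTo G _ x

lemma inclAt_d_succ {k : ℕ} (S : Index a (k + 1 + 1)) (x : below S.1) :
    inclAt G a S x ≫ d G a prec (k + 1) = ∑ s : S.1, (-1 : ℤ) ^ position prec S.1 s.1 •
      inclAt G a (S.erase s) ⟨x.1, below_mono (S.erase_subset s) x.2⟩ := by
  rw [inclAt, Category.assoc, incl_d_succ, Preadditive.comp_sum]
  refine Finset.sum_congr rfl fun s _ => ?_
  rw [Preadditive.comp_zsmul, ← Category.assoc, inj_colimMap, inclAt]

variable {G} {G' G'' : I ⥤ FGModuleCat.{u} K}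

/-- The map of the terms of the Koszul complexes induced by a natural transformation. -/
def XMap (f : G ⟶ G') : ∀ k, X G a k ⟶ X G' a k
  | 0 => f.app a
  | _ + 1 => desc G a fun S => colimOnMap f (below S.1) ≫ incl G' a S

lemma inclAt_XMap (f : G ⟶ G') {k : ℕ} (S : Index a (k + 1)) (x : below S.1) :
    inclAt G a S x ≫ XMap a f (k + 1) = f.app x.1 ≫ inclAt G' a S x := by
  rw [inclAt, Category.assoc, XMap, incl_desc, ← Category.assoc, inj_colimOnMap, Category.assoc,
    inclAt]

lemma XMap_d (f : G ⟶ G') (k : ℕ) :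
    XMap a f (k + 1) ≫ d G' a prec k = d G a prec k ≫ XMap a f k := by
  refine hom_ext_inclAt fun S x => ?_
  rw [← Category.assoc, inclAt_XMap, Category.assoc, ← Category.assoc (inclAt G a S x)]
  cases k with
  | zero =>
    rw [inclAt_d_zero, inclAt_d_zero]
    exact (f.naturality _).symm
  | succ k =>
    rw [inclAt_d_succ, inclAt_d_succ, Preadditive.comp_sum, Preadditive.sum_comp]
    refine Finset.sum_congr rfl fun s _ => ?_
    rw [Preadditive.comp_zsmul, Preadditive.zsmul_comp, inclAt_XMap]

lemma XMap_comp (f : G ⟶ G') (g : G' ⟶ G'') (k : ℕ) :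
    XMap a f k ≫ XMap a g k = XMap a (f ≫ g) k := by
  cases k with
  | zero => rfl
  | succ k =>
    refine hom_ext_inclAt fun S x => ?_
    rw [← Category.assoc, inclAt_XMap, Category.assoc, inclAt_XMap, inclAt_XMap,
      ← Category.assoc]
    rfl

lemma XMap_zero (k : ℕ) : XMap a (0 : G ⟶ G') k = 0 := by
  cases k with
  | zero => rfl
  | succ k =>
    refine hom_ext_inclAt fun S x => ?_
    rw [inclAt_XMap, comp_zero]
    exact zero_comp

/-- The map of Koszul complexes induced by a natural transformation. -/
def complexMap [IsStrictTotalOrder (parents a) prec] (f : G ⟶ G') :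
    complex G a prec ⟶ complex G' a prec :=
  ChainComplex.ofHom (XMap a f) fun k => by
    have h : ∀ G : I ⥤ FGModuleCat.{u} K, (complex G a prec).d (k + 1) k = d G a prec k :=
      fun G => ChainComplex.of_d (X G a) (d G a prec) k
    rw [h, h]
    exact XMap_d a prec f k

lemma complex_d (G : I ⥤ FGModuleCat.{u} K) [IsStrictTotalOrder (parents a) prec] (k : ℕ) :
    (complex G a prec).d (k + 1) k = d G a prec k :=
  ChainComplex.of_d (X G a) (d G a prec) k

end Functoriality

/-! ### Exactness properties of the Koszul terms -/

section Exactness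

variable {K : Type u} [Field K] {I : Type w} [PartialOrder I]
  {S : ShortComplex (I ⥤ FGModuleCat.{u} K)}

lemma shortExact_app (hS : S.ShortExact) (x : I) :
    (ShortComplex.mk (S.f.app x) (S.g.app x) (congrArg (fun f => f.app x) S.zero)).ShortExact :=
  hS.map_of_exact ((evaluation I (FGModuleCat.{u} K)).obj x)

variable (a : I)

lemma exists_isGreatest_below_of_card_one (T : Index a 1) : ∃ p, IsGreatest (below T.1) p := by
  obtain ⟨s, hs⟩ := Finset.card_eq_one.1 T.2.1
  refine ⟨s.1, fun t ht => ?_, fun x hx => hx s ?_⟩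
  · rw [hs, Finset.mem_singleton] at ht
    rw [ht]
  · rw [hs]
    exact Finset.mem_singleton_self s

lemma exists_isGreatest_below_of_isGLB (h : ∀ T : Set I, T ⊆ parents a → T.Nonempty →
    HasAncestor T → ∃ p : I, IsGLB T p) {k : ℕ} (T : Index a (k + 1)) :
    ∃ p, IsGreatest (below T.1) p := by
  obtain ⟨s, hs⟩ : T.1.Nonempty := by
    rw [← Finset.card_pos, T.2.1]
    exact k.succ_pos
  obtain ⟨p, hp⟩ := h ((↑) '' (T.1 : Set (parents a))) (by rintro _ ⟨t, -, rfl⟩; exact t.2)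
    ⟨s.1, s, hs, rfl⟩ T.2.2
  refine ⟨p, fun t ht => hp.1 ⟨t, ht, rfl⟩, fun x hx => hp.2 ?_⟩
  rintro _ ⟨t, ht, rfl⟩
  exact hx t ht

variable [Finite I]

lemma epi_XMap (hS : S.ShortExact) (k : ℕ) : Epi (XMap a S.g k) := by
  cases k with
  | zero => exact (shortExact_app hS a).epi_g
  | succ k =>
    refine ⟨fun f g h => hom_ext_inclAt fun T x => ?_⟩
    have := (shortExact_app hS x.1).epi_g
    dsimp only at this
    rw [← cancel_epi (S.g.app x.1), ← Category.assoc, ← inclAt_XMap, Category.assoc, h,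
      ← Category.assoc, inclAt_XMap, Category.assoc]

/-- The map descends separately on each value `S.X₂(x)`; the descents are compatible because the
components of `S.g` are epi. -/
lemma exists_XMap_comp_eq (hS : S.ShortExact) {k : ℕ} {M : FGModuleCat.{u} K}
    (φ : X S.X₂ a (k + 1) ⟶ M) (hφ : XMap a S.f (k + 1) ≫ φ = 0) :
    ∃ ψ : X S.X₃ a (k + 1) ⟶ M, XMap a S.g (k + 1) ≫ ψ = φ := by
  have hepi : ∀ x, Epi (S.g.app x) := fun x => (shortExact_app hS x).epi_g
  have key : ∀ (T : Index a (k + 1)) (x : below T.1), ∃ t : S.X₃.obj x.1 ⟶ M,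
      S.g.app x.1 ≫ t = inclAt S.X₂ a T x ≫ φ := by
    intro T x
    have h0 : S.f.app x.1 ≫ inclAt S.X₂ a T x ≫ φ = 0 := by
      rw [← Category.assoc, ← inclAt_XMap, Category.assoc, hφ, comp_zero]
    have hx := shortExact_app hS x.1
    have := hx.epi_g
    exact ⟨hx.exact.desc _ h0, hx.exact.g_desc _ h0⟩
  choose t ht using key
  refine ⟨descAt S.X₃ a t fun T x y h => ?_, hom_ext_inclAt fun T x => ?_⟩
  · rw [← cancel_epi (S.g.app x.1), ← Category.assoc, ← S.g.naturality, Category.assoc, ht, ht,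
      ← Category.assoc, map_inclAt]
  · rw [← Category.assoc, inclAt_XMap, Category.assoc, inclAt_descAt, ht]

lemma XMap_exact (hS : S.ShortExact) (k : ℕ) :
    (ShortComplex.mk (XMap a S.f k) (XMap a S.g k)
      (by rw [XMap_comp, S.zero, XMap_zero])).Exact := by
  cases k with
  | zero => exact (shortExact_app hS a).exact
  | succ k =>
    have := epi_XMap a hS (k + 1)
    choose ψ hψ using fun (M : FGModuleCat.{u} K) => exists_XMap_comp_eq a hS (k := k) (M := M)
    exact ShortComplex.exact_of_g_is_cokernel _ (CokernelCofork.IsColimit.ofπ _ _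
      (fun {M} φ hφ => ψ M φ hφ) (fun {M} φ hφ => hψ M φ hφ)
      (fun {M} φ hφ m hm => (cancel_epi (XMap a S.g (k + 1))).1 (hm.trans (hψ M φ hφ).symm)))

open Classical in
/-- The projection of the Koszul complex to the summand of `T`, when there is a largest element
below `T`. -/
def projAt (G : I ⥤ FGModuleCat.{u} K) {k : ℕ} (T : Index a (k + 1)) {p : I}
    (hp : IsGreatest (below T.1) p) : X G a (k + 1) ⟶ G.obj p :=
  desc G a fun T' => if h : T' = T then colimTo G (fun _ hx => hp.2 (h ▸ hx)) else 0

lemma inclAt_projAt_self (G : I ⥤ FGModuleCat.{u} K) {k : ℕ} (T : Index a (k + 1)) {p : I}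
    (hp : IsGreatest (below T.1) p) (x : below T.1) :
    inclAt G a T x ≫ projAt a G T hp = G.map (homOfLE (hp.2 x.2)) := by
  rw [inclAt, Category.assoc, projAt, incl_desc, dif_pos rfl]
  exact inj_colimTo G _ x

lemma inclAt_projAt_of_ne (G : I ⥤ FGModuleCat.{u} K) {k : ℕ} {T T' : Index a (k + 1)} {p : I}
    (hp : IsGreatest (below T.1) p) (h : T' ≠ T) (x : below T'.1) :
    inclAt G a T' x ≫ projAt a G T hp = 0 := by
  rw [inclAt, Category.assoc, projAt, incl_desc, dif_neg h, comp_zero]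

lemma XMap_projAt {G G' : I ⥤ FGModuleCat.{u} K} (f : G ⟶ G') {k : ℕ} (T : Index a (k + 1))
    {p : I} (hp : IsGreatest (below T.1) p) :
    XMap a f (k + 1) ≫ projAt a G' T hp = projAt a G T hp ≫ f.app p := by
  refine hom_ext_inclAt fun T' x => ?_
  rw [← Category.assoc, inclAt_XMap, Category.assoc, ← Category.assoc (inclAt G a T' x)]
  by_cases h : T' = T
  · subst h
    rw [inclAt_projAt_self, inclAt_projAt_self, f.naturality]
  · rw [inclAt_projAt_of_ne _ _ _ h, inclAt_projAt_of_ne _ _ _ h, comp_zero, zero_comp]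

/-- A greatest element `p T` is terminal in the indexing poset, so the colimit is the value at `p
T`. The term is then naturally a direct sum of such values, on which `S.f` is mono. -/
lemma mono_XMap (hS : S.ShortExact) (k : ℕ)
    (h : ∀ T : Index a (k + 1), ∃ p, IsGreatest (below T.1) p) : Mono (XMap a S.f (k + 1)) := by
  classical
  choose p hp using h
  have : Fintype (Index a (k + 1)) := Fintype.ofFinite _
  have hid : ∑ T : Index a (k + 1), projAt a S.X₁ T (hp T) ≫ inclAt S.X₁ a T ⟨p T, (hp T).1⟩ =
      𝟙 (X S.X₁ a (k + 1)) := by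
    refine hom_ext_inclAt fun T x => ?_
    rw [Preadditive.comp_sum, Category.comp_id, Finset.sum_eq_single T]
    · rw [← Category.assoc, inclAt_projAt_self]
      exact map_inclAt S.X₁ a T (x := x) (y := ⟨p T, (hp T).1⟩) _
    · intro T' _ hT'
      rw [← Category.assoc, inclAt_projAt_of_ne _ _ _ hT'.symm, zero_comp]
    · exact fun h => absurd (Finset.mem_univ _) h
  refine Preadditive.mono_of_cancel_zero _ fun {M} y hy => ?_
  rw [← Category.comp_id y, ← hid, Preadditive.comp_sum]
  refine Finset.sum_eq_zero fun T _ => ?_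
  have hm : Mono (S.f.app (p T)) := (shortExact_app hS (p T)).mono_f
  have h0 : y ≫ projAt a S.X₁ T (hp T) = 0 := by
    rw [← cancel_mono (S.f.app (p T)), Category.assoc, ← XMap_projAt, ← Category.assoc, hy,
      zero_comp, zero_comp]
  rw [← Category.assoc, h0, zero_comp]

end Exactness

/-! ### Dimension shifting without full left exactness -/

section DimensionShift

variable {C : Type*} [Category* C] [Abelian C] {A B D : ChainComplex C ℕ}

/-- Replace `A` by the kernel of `v`. The comparison `l` is epi everywhere and mono up to degree
`i`, so it is an isomorphism on `H_i`. The connecting map of the kernel sequence is mono by `hB` and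
epi by `h0`. -/
lemma nonempty_homology_iso (u : A ⟶ B) (v : B ⟶ D) (w : ∀ i, u.f i ≫ v.f i = 0)
    (hex : ∀ i, (ShortComplex.mk (u.f i) (v.f i) (w i)).Exact) (hv : ∀ i, Epi (v.f i)) (i : ℕ)
    (hm : ∀ j ≤ i, Mono (u.f j)) (hB : IsZero (B.homology (i + 1)))
    (h0 : HomologicalComplex.homologyMap u i = 0) :
    Nonempty (A.homology i ≅ D.homology (i + 1)) := by
  have hw : u ≫ v = 0 := by
    ext i
    exact w i
  have : Epi v := HomologicalComplex.epi_of_epi_f v hv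
  let l : A ⟶ kernel v := kernel.lift v u hw
  have hl : l ≫ kernel.ι v = u := kernel.lift_ι _ _ _
  have hlf : ∀ j, l.f j ≫ (kernel.ι v).f j = u.f j := fun j => by
    rw [← HomologicalComplex.comp_f, hl]
  have hS : (ShortComplex.mk (kernel.ι v) v (kernel.condition v)).ShortExact :=
    { exact := ShortComplex.exact_kernel v, mono_f := inferInstance, epi_g := inferInstance }
  have hmono : ∀ j ≤ i, Mono (l.f j) := fun j hj => by
    have := hm j hj
    rw [← hlf] at this
    exact mono_of_mono _ ((kernel.ι v).f j)
  have hepi : ∀ j, Epi (l.f j) := fun j => by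
    rw [epi_iff_surjective_up_to_refinements]
    intro T y
    have hy : (y ≫ (kernel.ι v).f j) ≫ v.f j = 0 := by
      rw [Category.assoc, ← HomologicalComplex.comp_f, kernel.condition,
        HomologicalComplex.zero_f, comp_zero]
    obtain ⟨T', p, hp, z, hz⟩ := (hex j).exact_up_to_refinements (y ≫ (kernel.ι v).f j) hy
    refine ⟨T', p, hp, z, ?_⟩
    rw [← cancel_mono ((kernel.ι v).f j), Category.assoc, Category.assoc, hlf]
    exact hz
  have hq : QuasiIsoAt l i := by
    rw [quasiIsoAt_iff]
    have h1 : Epi ((HomologicalComplex.shortComplexFunctor C _ i).map l).τ₁ := hepi _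
    have h2 : IsIso ((HomologicalComplex.shortComplexFunctor C _ i).map l).τ₂ := by
      have := hmono i le_rfl
      have := hepi i
      exact isIso_of_mono_of_epi (l.f i)
    have h3 : Mono ((HomologicalComplex.shortComplexFunctor C _ i).map l).τ₃ := by
      refine hmono _ ?_
      cases i with
      | zero => simp
      | succ i => simp
    exact ShortComplex.quasiIso_of_epi_of_isIso_of_mono _
  have hli : IsIso (HomologicalComplex.homologyMap l i) := inferInstance
  have hzero : HomologicalComplex.homologyMap (kernel.ι v) i = 0 := by
    rw [← cancel_epi (HomologicalComplex.homologyMap l i), ← HomologicalComplex.homologyMap_comp,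
      hl, h0, comp_zero]
  have hr : (ComplexShape.down ℕ).Rel (i + 1) i := rfl
  have hδm : Mono (hS.δ (i + 1) i hr) := hS.mono_δ _ _ _ hB
  have hδe : Epi (hS.δ (i + 1) i hr) :=
    (hS.homology_exact₁ _ _ _).epi_f hzero
  have hδ : IsIso (hS.δ (i + 1) i hr) := isIso_of_mono_of_epi _
  exact ⟨asIso (HomologicalComplex.homologyMap l i) ≪≫ (asIso (hS.δ (i + 1) i hr)).symm⟩

end DimensionShift

/-! ### Koszul homology in degree zero -/

section DegreeZero

variable {K : Type u} [Field K] {I : Type w} [PartialOrder I]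

/-- The projection to the generators of a cover factors through the covered functor. -/
lemma IsCover.exists_factorization {P F : I ⥤ FGModuleCat.{u} K} {V : I → FGModuleCat.{u} K}
    (e : FreeGenerators P V) {π : P ⟶ F} (hπ : IsCover π) (a : I) :
    ∃ q : F.obj a ⟶ V a, π.app a ≫ q = e.proj a := by
  have : Epi (π.app a) := (NatTrans.epi_iff_epi_app π).1 hπ.epi a
  have h0 : kernel.ι (π.app a) ≫ e.proj a = 0 := by
    ext z
    refine e.radical_le_ker_proj a (hπ.mem_radical a _ ?_)
    exact congrArg (fun g => g.hom.hom z) (kernel.condition (π.app a))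
  exact ⟨Abelian.epiDesc _ _ h0, Abelian.comp_epiDesc _ _ h0⟩

variable [Finite I] {a : I} (prec : parents a → parents a → Prop)

lemma exists_parent_ge {b : I} (h : b < a) : ∃ s : parents a, b ≤ s.1 := by
  obtain ⟨s, hs, hsa⟩ := exists_le_covBy_of_lt h
  exact ⟨⟨s, hsa⟩, hs⟩

/-- The one-element index. -/
def Index.singleton (s : parents a) : Index a 1 :=
  ⟨{s}, Finset.card_singleton s, s.1, by simp⟩

/-- Every `b < a` lies below a parent of `a`. With the converse that follows, this identifies the
image of the first differential with the radical. -/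
lemma map_comp_eq_zero_of_d_comp {F : I ⥤ FGModuleCat.{u} K} {M : FGModuleCat.{u} K}
    {φ : F.obj a ⟶ M} (h : d F a prec 0 ≫ φ = 0) {b : I} (hb : b < a) :
    F.map (homOfLE hb.le) ≫ φ = 0 := by
  obtain ⟨s, hs⟩ := exists_parent_ge hb
  have hbs : b ∈ below (Index.singleton s).1 := fun t ht => by
    rw [Finset.mem_singleton.1 ht]
    exact hs
  rw [← inclAt_d_zero F a prec (Index.singleton s) ⟨b, hbs⟩]
  exact (Category.assoc _ _ _).trans ((congrArg _ h).trans comp_zero)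

lemma d_comp_eq_zero_of_map_comp {F : I ⥤ FGModuleCat.{u} K} {M : FGModuleCat.{u} K}
    {φ : F.obj a ⟶ M} (h : ∀ (b : I) (hb : b < a), F.map (homOfLE hb.le) ≫ φ = 0) :
    d F a prec 0 ≫ φ = 0 := by
  refine hom_ext_inclAt fun T x => ?_
  obtain ⟨s, hs⟩ : T.1.Nonempty := by
    rw [← Finset.card_pos, T.2.1]
    exact Nat.one_pos
  have hx : x.1 < a := (x.2 s hs).trans_lt s.2.lt
  rw [comp_zero, ← h x.1 hx, ← inclAt_d_zero F a prec T x]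
  exact (Category.assoc _ _ _).symm

lemma IsCover.nonempty_iso_homology_zero [IsStrictTotalOrder (parents a) prec]
    {P F : I ⥤ FGModuleCat.{u} K} {V : I → FGModuleCat.{u} K}
    (e : FreeGenerators P V) {π : P ⟶ F} (hπ : IsCover π) :
    Nonempty (V a ≅ (complex F a prec).homology 0) := by
  obtain ⟨q, hq⟩ := hπ.exists_factorization e a
  have hepi : ∀ x, Epi (π.app x) := fun x => (NatTrans.epi_iff_epi_app π).1 hπ.epi x
  have hq_map : ∀ (b : I) (hb : b < a), F.map (homOfLE hb.le) ≫ q = 0 := fun b hb => by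
    rw [← cancel_epi (π.app b), ← Category.assoc, ← π.naturality, Category.assoc, hq,
      e.map_proj hb, comp_zero]
  have hqe : Epi q := by
    have : Epi (π.app a ≫ q) := by
      rw [hq]
      exact (SplitEpi.mk (e.gen a) (e.gen_proj a)).epi
    exact epi_of_epi (π.app a) q
  have hd : (complex F a prec).d 1 0 ≫ q = 0 := by
    rw [complex_d]
    exact d_comp_eq_zero_of_map_comp prec hq_map
  -- This makes `q` a cokernel of the first differential: the factorization of `φ` uses the section
  -- `e.gen a ≫ π.app a` of `q`.
  have hfac : ∀ {M : FGModuleCat.{u} K} (φ : F.obj a ⟶ M),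
      (complex F a prec).d 1 0 ≫ φ = 0 → q ≫ e.gen a ≫ π.app a ≫ φ = φ := by
    intro M φ hφ
    rw [complex_d] at hφ
    rw [← cancel_epi (π.app a), ← Category.assoc, hq]
    refine e.hom_ext fun b hb => ?_
    rcases hb.eq_or_lt with rfl | hlt
    · have : P.map (homOfLE hb) = 𝟙 _ := P.map_id b
      rw [this, Category.id_comp, Category.id_comp, ← Category.assoc (e.gen b), e.gen_proj,
        Category.id_comp]
    · have h1 : P.map (homOfLE hb) ≫ e.proj a = 0 := e.map_proj hlt
      have h2 : F.map (homOfLE hb) ≫ φ = 0 := map_comp_eq_zero_of_d_comp prec hφ hlt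
      rw [← Category.assoc (P.map _), h1, zero_comp, comp_zero, ← Category.assoc (P.map _),
        π.naturality, Category.assoc, h2, comp_zero, comp_zero]
  have hc : IsColimit (CokernelCofork.ofπ q hd) := CokernelCofork.IsColimit.ofπ _ _
    (fun φ _ => e.gen a ≫ π.app a ≫ φ) (fun φ hφ => hfac φ hφ)
    (fun φ hφ m hm => (cancel_epi q).1 (hm.trans (hfac φ hφ).symm))
  exact ⟨hc.coconePointUniqueUpToIso ((complex F a prec).opcyclesIsCokernel 1 0 (by simp)) ≪≫
    (ChainComplex.isoHomologyι₀ (complex F a prec)).symm⟩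

/-- The radical of `P` at `a` dies in the cokernel of the first differential, into which `H_0`
embeds. -/
lemma homologyMap_zero_eq_zero [IsStrictTotalOrder (parents a) prec]
    {Z P : I ⥤ FGModuleCat.{u} K} (f : Z ⟶ P) (hf : ∀ v, (f.app a).hom.hom v ∈ radical P a) :
    HomologicalComplex.homologyMap (complexMap a prec f) 0 = 0 := by
  have h1 : f.app a ≫ (show P.obj a ⟶ _ from (complex P a prec).pOpcycles 0) = 0 := by
    have h2 : radical P a ≤ LinearMap.ker
        (show P.obj a ⟶ _ from (complex P a prec).pOpcycles 0).hom.hom := by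
      rw [radical_le_ker_iff]
      intro x hx
      refine map_comp_eq_zero_of_d_comp prec ?_ hx
      rw [← complex_d]
      exact (complex P a prec).d_pOpcycles 1 0
    ext v
    exact h2 (hf v)
  have h3 : HomologicalComplex.opcyclesMap (complexMap a prec f) 0 = 0 := by
    rw [← cancel_epi ((complex Z a prec).pOpcycles 0), HomologicalComplex.p_opcyclesMap, comp_zero]
    exact h1
  rw [← cancel_mono ((complex P a prec).homologyι 0), HomologicalComplex.homologyι_naturality, h3,
    comp_zero, zero_comp]

end DegreeZero

/-! ### Signs and the cone contraction of a simplex -/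

section Homotopy

variable {I : Type w} [PartialOrder I] {a : I} (prec : parents a → parents a → Prop)

/-- The sign of `s` in `T`. -/
def sign (T : Finset (parents a)) (s : parents a) : ℤ := (-1) ^ position prec T s

lemma sign_mul_self (T : Finset (parents a)) (s : parents a) :
    sign prec T s * sign prec T s = 1 := by
  rw [sign, ← mul_pow]; simp

open Classical in
-- The contraction of a simplex with apex `σ`: insert `σ` with its sign, or give zero if `σ` is
-- already present. For `σ ∈ T` only the face opposite `σ` contributes. For `σ ∉ T` removing `σ`
-- again gives `g T`, and the other faces cancel in pairs by `sign_swap`.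
lemma cone_identity [IsStrictTotalOrder (parents a) prec] {M : Type*} [AddCommGroup M]
    (g : Finset (parents a) → M) (σ : parents a) (T : Finset (parents a)) :
    (∑ s ∈ T, sign prec T s • (if σ ∈ T.erase s then 0 else
      sign prec (insert σ (T.erase s)) σ • g (insert σ (T.erase s)))) +
    (if σ ∈ T then 0 else sign prec (insert σ T) σ •
      ∑ s ∈ insert σ T, sign prec (insert σ T) s • g ((insert σ T).erase s)) = g T := by
  by_cases hσ : σ ∈ T
  · rw [if_pos hσ, add_zero, Finset.sum_eq_single_of_mem σ hσ]
    · rw [if_neg (Finset.notMem_erase σ T), Finset.insert_erase hσ, smul_smul, sign_mul_self,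
        one_smul]
    · intro s _ hs
      rw [if_pos (Finset.mem_erase.2 ⟨hs.symm, hσ⟩), smul_zero]
  · rw [if_neg hσ, Finset.sum_insert hσ, smul_add, smul_smul, sign_mul_self, one_smul,
      Finset.erase_insert hσ, add_left_comm, Finset.smul_sum, ← Finset.sum_add_distrib,
      Finset.sum_eq_zero, add_zero]
    intro s hs
    have hne : σ ≠ s := fun h => hσ (h ▸ hs)
    rw [if_neg (fun h => hσ (Finset.mem_of_mem_erase h)), Finset.erase_insert_of_ne hne,
      smul_smul, smul_smul, ← add_smul]
    have h := sign_swap prec (S := insert σ T) (Finset.mem_insert_self σ T)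
      (Finset.mem_insert_of_mem hs) hne
    rw [Finset.erase_insert hσ, Finset.erase_insert_of_ne hne, pow_add, pow_add] at h
    have hA := sign_mul_self prec (insert σ T) σ
    have hD := sign_mul_self prec (insert σ (T.erase s)) σ
    change sign prec (insert σ T) σ * sign prec T s +
      sign prec (insert σ T) s * sign prec (insert σ (T.erase s)) σ = 0 at h
    -- Multiply the relation `h` by two signs, whose squares are `1`.
    rw [show sign prec T s * sign prec (insert σ (T.erase s)) σ +
      sign prec (insert σ T) σ * sign prec (insert σ T) s = 0 by
        linear_combination (sign prec (insert σ T) σ * sign prec (insert σ (T.erase s)) σ) * h -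
          sign prec T s * sign prec (insert σ (T.erase s)) σ * hA -
          sign prec (insert σ T) σ * sign prec (insert σ T) s * hD, zero_smul]

end Homotopy

/-! ### Acyclicity for free functors -/

section Free

variable {K : Type u} [Field K] {I : Type w} [PartialOrder I] [Finite I] {a : I}
  (prec : parents a → parents a → Prop) {P : I ⥤ FGModuleCat.{u} K} {V : I → FGModuleCat.{u} K}
  (e : FreeGenerators P V)

open Classical in
/-- The inclusion of the generators at `b` into the summand of `T`. -/
def FreeGenerators.genAt {b : I} (hb : b ≤ a) : ∀ (k : ℕ), Finset (parents a) → (V b ⟶ X P a k)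
  | 0, _ => e.gen b ≫ P.map (homOfLE hb)
  | k + 1, T => if h : T.card = k + 1 ∧ ∀ s ∈ T, b ≤ s.1 then
      e.gen b ≫ inclAt P a ⟨T, h.1, b, by rintro _ ⟨s, hs, rfl⟩; exact h.2 s hs⟩ ⟨b, h.2⟩ else 0

open Classical in
lemma FreeGenerators.genAt_d [IsStrictTotalOrder (parents a) prec] {b : I} (hb : b ≤ a) (k : ℕ)
    {T : Finset (parents a)} (hT : T.card = k + 1) (hbT : ∀ s ∈ T, b ≤ s.1) :
    e.genAt hb (k + 1) T ≫ d P a prec k =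
      ∑ s ∈ T, sign prec T s • e.genAt hb k (T.erase s) := by
  rw [genAt, dif_pos ⟨hT, hbT⟩, Category.assoc]
  cases k with
  | zero =>
    rw [inclAt_d_zero]
    obtain ⟨s, rfl⟩ := Finset.card_eq_one.1 hT
    rw [Finset.sum_singleton]
    have : sign prec {s} s = 1 := by
      rw [sign, position, Finset.filter_singleton, if_neg (irrefl_of prec s), Finset.card_empty,
        pow_zero]
    rw [this, one_smul, genAt]
  | succ k =>
    rw [inclAt_d_succ, Preadditive.comp_sum]
    refine Eq.trans ?_ (Finset.sum_coe_sort T fun s => sign prec T s • e.genAt hb (k + 1)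
      (T.erase s))
    refine Finset.sum_congr rfl fun s _ => ?_
    have hc : (T.erase s.1).card = k + 1 := by
      rw [Finset.card_erase_of_mem s.2, hT, Nat.add_sub_cancel]
    rw [Preadditive.comp_zsmul, genAt,
      dif_pos ⟨hc, fun t ht => hbT t (Finset.mem_of_mem_erase ht)⟩]
    rfl

lemma FreeGenerators.hom_ext_genAt {k : ℕ} {M : FGModuleCat.{u} K} {f g : X P a (k + 1) ⟶ M}
    (h : ∀ (b : I) (hb : b < a) (T : Finset (parents a)), T.card = k + 1 → (∀ s ∈ T, b ≤ s.1) →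
      e.genAt hb.le (k + 1) T ≫ f = e.genAt hb.le (k + 1) T ≫ g) : f = g := by
  refine hom_ext_inclAt fun T x => e.hom_ext fun b hb => ?_
  obtain ⟨s, hs⟩ : T.1.Nonempty := by
    rw [← Finset.card_pos, T.2.1]
    exact k.succ_pos
  have hbT : ∀ s ∈ T.1, b ≤ s.1 := fun s hs => hb.trans (x.2 s hs)
  have := h b ((hbT s hs).trans_lt s.2.lt) T.1 T.2.1 hbT
  rw [genAt, dif_pos ⟨T.2.1, hbT⟩, Category.assoc, Category.assoc] at this
  rw [← Category.assoc (P.map _), ← Category.assoc (P.map _),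
    map_inclAt P a T (x := ⟨b, hbT⟩) (y := x) hb]
  exact this

/-- Generators at `a` itself occur only in degree `0`, where they are sent to zero. -/
lemma FreeGenerators.exists_desc_genAt {M : FGModuleCat.{u} K} (k : ℕ)
    (f : ∀ b, b < a → Finset (parents a) → (V b ⟶ M)) :
    ∃ φ : X P a k ⟶ M, ∀ (b : I) (hb : b < a) (T : Finset (parents a)), T.card = k →
      (∀ s ∈ T, b ≤ s.1) → e.genAt hb.le k T ≫ φ = f b hb T := by
  classical
  cases k with
  | zero =>
    refine ⟨e.desc fun b _ => if h : b < a then f b h ∅ else 0, fun b hb T hT _ => ?_⟩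
    rw [Finset.card_eq_zero.1 hT]
    exact (Category.assoc _ _ _).trans ((e.fac _ b hb.le).trans (dif_pos hb))
  | succ k =>
    let t : ∀ (T : Index a (k + 1)) (x : below T.1), P.obj x.1 ⟶ M := fun T _ =>
      e.desc fun b _ => if h : b < a then f b h T.1 else 0
    have ht : ∀ T (x y : below T.1) (h : x.1 ≤ y.1), P.map (homOfLE h) ≫ t T y = t T x := by
      intro T x y h
      refine e.hom_ext fun b hb => ?_
      have hc : P.map (homOfLE hb) ≫ P.map (homOfLE h) = P.map (homOfLE (hb.trans h)) := by
        rw [← P.map_comp]; rfl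
      rw [← Category.assoc (P.map _), hc, e.fac, e.fac]
    refine ⟨descAt P a t ht, fun b hb T hT hbT => ?_⟩
    rw [genAt, dif_pos ⟨hT, hbT⟩, Category.assoc, inclAt_descAt]
    have h1 : P.map (homOfLE (le_refl b)) = 𝟙 _ := P.map_id b
    have := e.fac (x := b) (fun b _ => if h : b < a then f b h T else 0) b le_rfl
    rw [h1, Category.id_comp, dif_pos hb] at this
    exact this

/-- For each `b < a` the apex is a chosen parent of `a` above `b`, so `b` remains an ancestor after
inserting it. -/
lemma FreeGenerators.exists_homotopy (e : FreeGenerators P V)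
    [IsStrictTotalOrder (parents a) prec] (k : ℕ) :
    ∃ (h : X P a k ⟶ X P a (k + 1)) (h' : X P a (k + 1) ⟶ X P a (k + 2)),
      d P a prec k ≫ h + h' ≫ d P a prec (k + 1) = 𝟙 _ := by
  classical
  choose σ hσ using fun (b : I) (hb : b < a) => exists_parent_ge hb
  choose h hh using fun k => e.exists_desc_genAt k fun b hb T => if σ b hb ∈ T then 0 else
    sign prec (insert (σ b hb) T) (σ b hb) • e.genAt hb.le (k + 1) (insert (σ b hb) T)
  refine ⟨h k, h (k + 1), e.hom_ext_genAt fun b hb T hT hbT => ?_⟩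
  rw [Preadditive.comp_add, Category.comp_id, ← Category.assoc, ← Category.assoc,
    e.genAt_d prec hb.le k hT hbT, hh (k + 1) b hb T hT hbT, Preadditive.sum_comp,
    ← cone_identity prec (e.genAt hb.le (k + 1)) (σ b hb) T]
  congr 1
  · refine Finset.sum_congr rfl fun s hs => ?_
    rw [Preadditive.zsmul_comp, hh k b hb (T.erase s)
      (by rw [Finset.card_erase_of_mem hs, hT, Nat.add_sub_cancel])
      (fun t ht => hbT t (Finset.mem_of_mem_erase ht))]
  · split_ifs with hmem
    · exact zero_comp
    · rw [Preadditive.zsmul_comp, e.genAt_d prec hb.le (k + 1)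
        (by rw [Finset.card_insert_of_notMem hmem, hT])]
      intro s hs
      rcases Finset.mem_insert.1 hs with rfl | hs
      · exact hσ b hb
      · exact hbT s hs

lemma FreeGenerators.isZero_homology (e : FreeGenerators P V)
    [IsStrictTotalOrder (parents a) prec] (k : ℕ) :
    IsZero ((complex P a prec).homology (k + 1)) := by
  rw [← HomologicalComplex.exactAt_iff_isZero_homology,
    HomologicalComplex.exactAt_iff' _ (k + 2) (k + 1) k (by simp) (by simp),
    ShortComplex.exact_iff_exact_up_to_refinements]
  intro A x hx
  obtain ⟨h, h', hh⟩ := e.exists_homotopy prec k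
  have hx' : (show A ⟶ X P a (k + 1) from x) ≫ d P a prec k = 0 := by
    rw [← complex_d]
    exact hx
  refine ⟨A, 𝟙 A, inferInstance, (show A ⟶ X P a (k + 1) from x) ≫ h', ?_⟩
  have h1 : (show A ⟶ X P a (k + 1) from x) = (show A ⟶ X P a (k + 1) from x) ≫ h' ≫
      d P a prec (k + 1) := by
    conv_lhs => rw [← Category.comp_id (show A ⟶ X P a (k + 1) from x), ← hh,
      Preadditive.comp_add, ← Category.assoc, hx', zero_comp, zero_add]
  have h2 : (complex P a prec).d (k + 2) (k + 1) = d P a prec (k + 1) := complex_d a prec P (k + 1)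
  refine (Category.id_comp _).trans (h1.trans ?_)
  rw [← h2]
  exact (Category.assoc _ _ _).symm

end Free

/-! ### Betti diagrams as Koszul homology -/

section Main

variable {K : Type u} [Field K] {I : Type w} [PartialOrder I] [Finite I] {a : I}
  (prec : parents a → parents a → Prop)

/-- Dimension shifting down to degree `0`. The first shift, from `i` to `i - 1`, needs left
exactness in degrees at most `i - 1`, whence the bound in `hi`; degree `0` is automatic. -/
lemma HasBetti.nonempty_iso_homology [IsStrictTotalOrder (parents a) prec]
    {F : I ⥤ FGModuleCat.{u} K} {V : I → FGModuleCat.{u} K} {i : ℕ} (h : HasBetti F i V)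
    (hi : ∀ k, k + 1 < i → ∀ T : Index a (k + 1), ∃ p, IsGreatest (Koszul.below T.1) p) :
    Nonempty (V a ≅ (complex F a prec).homology i) := by
  induction h with
  | zero e π hπ => exact hπ.nonempty_iso_homology_zero prec e
  | @succ Z P F W V i e ι π hπ w h _ ih =>
    obtain ⟨f⟩ := ih fun k hk => hi k (by omega)
    have hmono : ∀ j ≤ i, Mono (XMap a ι j) := by
      intro j hj
      cases j with
      | zero => exact (shortExact_app h a).mono_f
      | succ j => exact mono_XMap a h j (hi j (by omega))
    -- In degree `0` the target need not vanish, but the syzygy lies in the radical.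
    have h0 : HomologicalComplex.homologyMap (complexMap a prec ι) i = 0 := by
      cases i with
      | zero =>
        refine homologyMap_zero_eq_zero prec ι fun v => hπ.mem_radical a _ ?_
        exact congrArg (fun g => (g.app a).hom.hom v) w
      | succ i => exact (e.isZero_homology prec i).eq_of_tgt _ _
    obtain ⟨g⟩ := nonempty_homology_iso (complexMap a prec ι) (complexMap a prec π)
      (fun j => (XMap_comp a ι π j).trans (by rw [w, XMap_zero]; rfl))
      (fun j => XMap_exact a h j) (fun j => epi_XMap a h j) i hmono
      (e.isZero_homology prec i) h0
    exact ⟨f ≪≫ g⟩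

end Main

end Koszul

end

theorem mainTheorem5 {K : Type u} [Field K] {I : Type w} [PartialOrder I] [Finite I]
    (G : I ⥤ FGModuleCat.{u} K) :
    (∃ P : Resolution G ⊤, P.IsMinimal) ∧
    ∀ (a : I) (prec : Koszul.parents a → Koszul.parents a → Prop)
      [IsStrictTotalOrder (Koszul.parents a) prec],
      (∀ i : ℕ, i ≤ 2 → ∀ V : I → FGModuleCat.{u} K, IsBettiDiagram G i V →
        Nonempty (V a ≅ (Koszul.complex G a prec).homology i)) ∧
      ((∀ S : Set I, S ⊆ Koszul.parents a → S.Nonempty → Koszul.HasAncestor S →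
          ∃ p : I, IsGLB S p) →
        ∀ (i : ℕ) (V : I → FGModuleCat.{u} K), IsBettiDiagram G i V →
          Nonempty (V a ≅ (Koszul.complex G a prec).homology i)) := by
  refine ⟨⟨_, Koszul.isMinimal_minimalResolution G⟩, fun a prec _ => ⟨fun i hi V hV => ?_,
    fun hglb i V hV => ?_⟩⟩
  · obtain ⟨n, P, hn, hP, hV⟩ := hV
    refine (Koszul.HasBetti.of_isMinimal hP hn hV).nonempty_iso_homology prec fun k hk T => ?_
    -- For `i ≤ 2` only single parents occur.
    obtain rfl : k = 0 := by omega
    exact Koszul.exists_isGreatest_below_of_card_one a T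
  · obtain ⟨n, P, hn, hP, hV⟩ := hV
    exact (Koszul.HasBetti.of_isMinimal hP hn hV).nonempty_iso_homology prec fun k _ T =>
      Koszul.exists_isGreatest_below_of_isGLB a hglb T
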